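/- For $0<\alpha\le 2$ and $d>0$ let $S(\alpha,d)$ be the symmetric stable law on $\mathbb{R}$ with characteristic function $t\mapsto \exp(-d|t|^{\alpha})$, and let $F_X(\cdot;\alpha,d)$ and $f_X(\cdot;\alpha,d)=F_X'(\cdot;\alpha,d)$ be its cumulative distribution function and its (continuous) probability density function. Let $0<q<1$, let $x_1,x_2,\dots$ be i.i.d. random variables with law $S(\alpha,d)$, and define the $q$-quantile estimator of $d$ based on the first $k$ of them by $$\hat d_{(\alpha),q}=\left(\frac{q\text{-Quantile}\{|x_j|,\ j=1,\dots,k\}}{q\text{-Quantile}\{|S(\alpha,1)|\}}\right)^{\alpha},$$ where the $q$-quantile of a distribution function $G$ is $\inf\{t: G(t)\ge q\}$; the one in the numerator is that of the empirical distribution function of $|x_1|,\dots,|x_k|$, i.e. the $\lceil qk\rceil$-th smallest of these values, and the one in the denominator is that of the distribution function of $|X|$ with $X\sim S(\alpha,1)$. Let $W=F_X^{-1}\left((q+1)/2;\alpha,1\right)$. Then $W$ is well defined (the only solution $y$ of $F_X(y;\alpha,1)=(q+1)/2$), $W=q\text{-Quantile}\{|S(\alpha,1)|\}$, $W>0$,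 $f_X(W;\alpha,1)>0$, the estimator $\hat d_{(\alpha),q}$ has a finite second moment for all sufficiently large $k$, and, as $k\to\infty$ with $\alpha,d,q$ fixed, $$\operatorname{Var}\left(\hat d_{(\alpha),q}\right)=\frac1k\,\frac{(q-q^2)\,\alpha^2/4}{f_X(W;\alpha,1)^2\,W^2}\,d^2+O\left(\frac1{k^2}\right).$$ -/

import Mathlib

open MeasureTheory ProbabilityTheory Filter Topology Asymptotics

noncomputable section

/-- `μ` is the symmetric stable law `S(α, d)` with index `α` and scale parameter `d`: the
probability measure on `ℝ` with characteristic function `t ↦ exp (-d |t| ^ α)`. -/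
def IsStableLaw (α d : ℝ) (μ : Measure ℝ) : Prop :=
  IsProbabilityMeasure μ ∧ ∀ t : ℝ, charFun μ t = ((Real.exp (-d * |t| ^ α) : ℝ) : ℂ)

theorem IsStableLaw.unique {α d : ℝ} {μ ν : Measure ℝ} (hμ : IsStableLaw α d μ)
    (hν : IsStableLaw α d ν) : μ = ν := by
  have := hμ.1
  have := hν.1
  exact Measure.ext_of_charFun (funext fun t => (hμ.2 t).trans (hν.2 t).symm)

open Classical in
/-- The symmetric stable law `S(α, d)`. It exists for `0 < α ≤ 2` and `0 ≤ d`, and it is unique by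
`IsStableLaw.unique`; for parameters without such a law the value is the zero measure, which is not
the law of any random variable. -/
def stableLaw (α d : ℝ) : Measure ℝ :=
  if h : ∃ μ : Measure ℝ, IsStableLaw α d μ then h.choose else 0

theorem IsStableLaw.stableLaw_eq {α d : ℝ} {μ : Measure ℝ} (hμ : IsStableLaw α d μ) :
    stableLaw α d = μ := by
  have h : ∃ μ : Measure ℝ, IsStableLaw α d μ := ⟨μ, hμ⟩
  rw [stableLaw, dif_pos h]
  exact h.choose_spec.unique hμ

/-- A random variable on a probability space whose law is `stableLaw α d` does have the
characteristic function `t ↦ exp (-d |t| ^ α)`, and conversely. -/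
theorem hasLaw_stableLaw_iff {Ω : Type*} [MeasurableSpace Ω] {P : Measure Ω}
    [IsProbabilityMeasure P] {X : Ω → ℝ} {α d : ℝ} :
    HasLaw X (stableLaw α d) P ↔ AEMeasurable X P ∧ IsStableLaw α d (P.map X) := by
  constructor
  · intro hX
    refine ⟨hX.aemeasurable, ?_⟩
    have hp : IsProbabilityMeasure (P.map X) := Measure.isProbabilityMeasure_map hX.aemeasurable
    rw [hX.map_eq] at hp ⊢
    by_cases h : ∃ μ : Measure ℝ, IsStableLaw α d μ
    · rw [stableLaw, dif_pos h]
      exact h.choose_spec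
    · rw [stableLaw, dif_neg h] at hp
      exact absurd rfl hp.ne_zero
  · rintro ⟨hm, hs⟩
    exact ⟨hm, hs.stableLaw_eq.symm⟩

/-- The cumulative distribution function `F_X(x; α, d)` of `X ∼ S(α, d)`. -/
def stableCDF (α d x : ℝ) : ℝ := cdf (stableLaw α d) x

/-- The probability density function `f_X(x; α, d)` of `X ∼ S(α, d)`, taken pointwise as the
derivative of the cumulative distribution function. -/
def stablePDF (α d x : ℝ) : ℝ := deriv (stableCDF α d) x

/-- The `p`-quantile (generalized inverse at `p`) of a distribution function `G`. -/
def quantile (G : ℝ → ℝ) (p : ℝ) : ℝ := sInf {t : ℝ | p ≤ G t}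

/-- The empirical distribution function of the sample `z 0, …, z (k - 1)`. -/
def empiricalCDF (k : ℕ) (z : ℕ → ℝ) (t : ℝ) : ℝ :=
  (((Finset.range k).filter fun j => z j ≤ t).card : ℝ) / k

/-- The `q`-quantile of `|S(α, 1)|`. -/
def absStableQuantile (α q : ℝ) : ℝ :=
  quantile (cdf ((stableLaw α 1).map fun x => |x|)) q

/-- The `q`-quantile estimator of the scale parameter, computed from the sample
`x 0, …, x (k - 1)`. -/
def quantileEstimator (α q : ℝ) (k : ℕ) (x : ℕ → ℝ) : ℝ :=
  (quantile (empiricalCDF k fun j => |x j|) q / absStableQuantile α q) ^ α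

end

/-!
The density of `S(α, 1)` is the inverse Fourier integral of `exp (-|t| ^ α)`. It is smooth, because
all moments of the characteristic function are finite (`eq_withDensity_invDensity`,
`IsStableLaw.contDiff_invDensity`), and it is positive everywhere (`IsStableLaw.invDensity_pos`):
stability makes the set where it is positive star-shaped about `0`, so a zero would bound the
support, which the characteristic function does not allow. Hence the distribution function is a
smooth strictly increasing bijection onto `(0, 1)`, which gives the claims on `W`.

After division by `d ^ (1 / α)` the sample has law `S(α, 1)`. Let `G` be the distribution function
of `|X|` and `Q` the empirical `q`-quantile, that is, the order statistic of rank `⌈q k⌉`. Then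
`U = G Q` is the same order statistic of a uniform sample (`map_eq_orderLaw`). Its law is a Beta law
whose moments are explicit: the variance is `q (1 - q) / k + O(1 / k ^ 2)`, and `cov(V, V ^ 2)` and
`E[V ^ 4]` are `O(1 / k ^ 2)` for `V = U - q`.

The estimator is `d (Q / W) ^ α = d + c₁ V + c₂ V ^ 2 + R` with `c₁ = d α / (2 W f(W))`. Since
`P(|X| > t) = O(t ^ (-α))`, the estimator is `O(1 / (1 - U))`, so the local Taylor bound on `R`
extends to the global bound `|R| ≤ C |V| ^ 3 / (1 - U)` (`exists_global_expansion`). The weight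
`(1 - U) ^ (-2)` turns one Beta density into a bounded multiple of another
(`integral_div_orderLaw`), which gives the second moment and shows that only `c₁ ^ 2 Var V`
contributes to the order `1 / k` (`variance_expansion`).
-/

open scoped FourierTransform

/-! ### Fourier inversion for probability measures on the line -/

/-- The real part of the inverse Fourier integral `∫ exp (-2 π i x ξ) φ (2 π ξ) dξ` of the
characteristic function `φ` of `μ`. If `φ` is integrable, this is the continuous density of `μ`. -/
noncomputable def invDensity (μ : Measure ℝ) (x : ℝ) : ℝ :=
  (𝓕 (fun ξ : ℝ => charFun μ (2 * Real.pi * ξ)) x).re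

/-- Fubini's theorem for a function and a finite measure: integrating `g` against the characteristic
function of `μ` is integrating the inverse Fourier transform of `g` against `μ`. -/
theorem integral_mul_charFun (μ : Measure ℝ) [IsFiniteMeasure μ] {g : ℝ → ℂ}
    (hg : Integrable g) :
    ∫ ξ, g ξ * charFun μ (2 * Real.pi * ξ) = ∫ y, 𝓕⁻ g y ∂μ := by
  have hL : Continuous fun p : ℝ × ℝ => (-(LinearMap.mul ℝ ℝ)) p.1 p.2 := by
    simp only [LinearMap.neg_apply, LinearMap.mul_apply']
    fun_prop
  have h := VectorFourier.integral_fourierIntegral_smul_eq_flip (μ := μ) (ν := volume)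
    (L := -(LinearMap.mul ℝ ℝ)) (f := fun _ => (1 : ℂ)) (g := g) Real.continuous_fourierChar
    hL (integrable_const _) hg
  convert h using 1
  · refine integral_congr_ae (ae_of_all _ fun ξ => ?_)
    simp only [VectorFourier.fourierIntegral, LinearMap.neg_apply, LinearMap.mul_apply', neg_neg,
      smul_eq_mul, charFun_apply_real]
    rw [mul_comm]
    congr 1
    refine integral_congr_ae (ae_of_all _ fun y => ?_)
    simp only [Circle.smul_def, Real.fourierChar_apply, smul_eq_mul, mul_one]
    push_cast
    ring_nf
  · refine integral_congr_ae (ae_of_all _ fun y => ?_)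
    simp only [one_smul]
    rw [Real.fourierInv_eq']
    simp only [VectorFourier.fourierIntegral, LinearMap.flip_apply, LinearMap.neg_apply,
      LinearMap.mul_apply', neg_neg, Circle.smul_def, Real.fourierChar_apply]
    refine integral_congr_ae (ae_of_all _ fun x => ?_)
    simp [mul_comm]

theorem integral_schwartz_eq_integral_mul_fourier (μ : Measure ℝ) [IsFiniteMeasure μ]
    (hμ : Integrable fun ξ : ℝ => charFun μ (2 * Real.pi * ξ)) (u : SchwartzMap ℝ ℂ) :
    ∫ x, u x ∂μ = ∫ x, u x * 𝓕 (fun ξ : ℝ => charFun μ (2 * Real.pi * ξ)) x := by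
  have h1 := integral_mul_charFun μ (g := 𝓕 (u : ℝ → ℂ)) (by
    rw [← SchwartzMap.fourier_coe]; exact SchwartzMap.integrable _)
  have h2 : 𝓕⁻ (𝓕 (u : ℝ → ℂ)) = u :=
    Continuous.fourierInv_fourier_eq u.continuous u.integrable (by
      rw [← SchwartzMap.fourier_coe]; exact SchwartzMap.integrable _)
  rw [h2] at h1
  rw [← h1]
  exact VectorFourier.integral_fourierIntegral_smul_eq_flip (μ := volume) (ν := volume)
    (L := innerₗ ℝ) Real.continuous_fourierChar
    (by simp only [innerₗ_apply_apply]; exact continuous_inner)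
    u.integrable hμ |>.trans (by simp [Real.fourier_eq, VectorFourier.fourierIntegral, mul_comm])

theorem continuous_invDensity (μ : Measure ℝ)
    (hμ : Integrable fun ξ : ℝ => charFun μ (2 * Real.pi * ξ)) : Continuous (invDensity μ) := by
  refine Complex.continuous_re.comp ?_
  exact VectorFourier.fourierIntegral_continuous Real.continuous_fourierChar
    (L := innerₗ ℝ) (by simp only [innerₗ_apply_apply]; exact continuous_inner) hμ

theorem integral_contDiff_eq_integral_mul_invDensity (μ : Measure ℝ) [IsFiniteMeasure μ]
    (hμ : Integrable fun ξ : ℝ => charFun μ (2 * Real.pi * ξ)) {u : ℝ → ℝ}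
    (hu : ContDiff ℝ (⊤ : ℕ∞) u) (hc : HasCompactSupport u) :
    ∫ x, u x ∂μ = ∫ x, u x * invDensity μ x := by
  have hc' : HasCompactSupport fun x => (u x : ℂ) := hc.comp_left (g := fun x : ℝ => (x : ℂ)) rfl
  have hu' : ContDiff ℝ (⊤ : ℕ∞) fun x => (u x : ℂ) := Complex.ofRealCLM.contDiff.comp hu
  have h := integral_schwartz_eq_integral_mul_fourier μ hμ (hc'.toSchwartzMap hu')
  have hF : Continuous (𝓕 (fun ξ : ℝ => charFun μ (2 * Real.pi * ξ))) :=
    VectorFourier.fourierIntegral_continuous Real.continuous_fourierChar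
      (L := innerₗ ℝ) (by simp only [innerₗ_apply_apply]; exact continuous_inner) hμ
  have hint : Integrable fun x => (u x : ℂ) * 𝓕 (fun ξ : ℝ => charFun μ (2 * Real.pi * ξ)) x :=
    (hu'.continuous.mul hF).integrable_of_hasCompactSupport hc'.mul_right
  have h' := congrArg Complex.re h
  have e1 : (∫ x, (hc'.toSchwartzMap hu') x ∂μ) = ((∫ x, u x ∂μ : ℝ) : ℂ) := by
    exact integral_ofReal (𝕜 := ℂ) (f := u)
  rw [e1, Complex.ofReal_re] at h'
  rw [h']
  refine (integral_re (𝕜 := ℂ) hint).symm.trans ?_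
  refine integral_congr_ae (ae_of_all _ fun x => ?_)
  simp [invDensity]

/-- The density is nonnegative because its integral against every bump function is. -/
theorem invDensity_nonneg (μ : Measure ℝ) [IsFiniteMeasure μ]
    (hμ : Integrable fun ξ : ℝ => charFun μ (2 * Real.pi * ξ)) (x : ℝ) : 0 ≤ invDensity μ x := by
  by_contra! hx
  have hcont := continuous_invDensity μ hμ
  obtain ⟨δ, hδ, hball⟩ := Metric.mem_nhds_iff.1 (hcont.continuousAt.eventually_lt_const hx)
  let u : ContDiffBump x := ⟨δ / 2, δ, by positivity, by linarith⟩
  have h1 := integral_contDiff_eq_integral_mul_invDensity μ hμ u.contDiff u.hasCompactSupport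
  have h2 : 0 ≤ ∫ y, u y ∂μ := integral_nonneg fun y => u.nonneg
  have h3 : 0 < ∫ y, -(u y * invDensity μ y) := by
    refine Continuous.integral_pos_of_hasCompactSupport_nonneg_nonzero (x := x)
      (u.continuous.mul hcont).neg ?_ ?_ ?_
    · exact (u.hasCompactSupport.mul_right (f' := invDensity μ)).comp_left (g := fun t => -t)
        neg_zero
    · intro y
      by_cases hy : y ∈ Metric.ball x δ
      · exact neg_nonneg.2 (mul_nonpos_of_nonneg_of_nonpos u.nonneg (hball hy).le)
      · have : u y = 0 := u.zero_of_le_dist (by simpa using hy)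
        simp [this]
    · have : u x = 1 := u.one_of_mem_closedBall (by simp [u.rIn_pos.le])
      simp [this, hx.ne]
  rw [integral_neg] at h3
  linarith

/-- Smooth cutoffs whose integrals converge to the measure of a closed interval. -/
theorem exists_bump_tendsto_measureReal_closedBall (c r : ℝ) (hr : 0 ≤ r) :
    ∃ u : ℕ → ContDiffBump c, ∀ ρ : Measure ℝ, IsLocallyFiniteMeasure ρ →
      Tendsto (fun n => ∫ x, u n x ∂ρ) atTop (𝓝 (ρ.real (Metric.closedBall c r))) := by
  let u : ℕ → ContDiffBump c := fun n =>
    ⟨r + 1 / (n + 1 : ℝ) / 2, r + 1 / (n + 1 : ℝ), by positivity, by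
      have : (0 : ℝ) < 1 / (n + 1 : ℝ) := by positivity
      linarith⟩
  refine ⟨u, fun ρ hρ => ?_⟩
  rw [← integral_indicator_one Metric.isClosed_closedBall.measurableSet]
  refine tendsto_integral_of_dominated_convergence
    ((Metric.closedBall c (r + 1)).indicator fun _ => (1 : ℝ))
    (fun n => (u n).continuous.aestronglyMeasurable) ?_ ?_ ?_
  · refine IntegrableOn.integrable_indicator ?_ Metric.isClosed_closedBall.measurableSet
    exact integrableOn_const (isCompact_closedBall c (r + 1)).measure_lt_top.ne
  · refine fun n => ae_of_all _ fun x => ?_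
    rw [Real.norm_of_nonneg (u n).nonneg]
    by_cases hx : x ∈ Metric.closedBall c (r + 1)
    · simpa [hx] using (u n).le_one
    · rw [Set.indicator_of_notMem hx, (u n).zero_of_le_dist]
      rw [Metric.mem_closedBall, not_le] at hx
      refine le_trans ?_ hx.le
      show r + 1 / (n + 1 : ℝ) ≤ r + 1
      have : 1 / (n + 1 : ℝ) ≤ 1 := by
        rw [div_le_one (by positivity)]; linarith [Nat.cast_nonneg (α := ℝ) n]
      linarith
  · refine ae_of_all _ fun x => tendsto_const_nhds.congr' ?_
    by_cases hx : x ∈ Metric.closedBall c r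
    · refine Eventually.of_forall fun n => ?_
      have h1 : u n x = 1 := by
        refine (u n).one_of_mem_closedBall ?_
        refine Metric.closedBall_subset_closedBall ?_ hx
        show r ≤ r + 1 / (n + 1 : ℝ) / 2
        have : (0 : ℝ) < 1 / (n + 1 : ℝ) := by positivity
        linarith
      simp [hx, h1]
    · rw [Set.indicator_of_notMem hx]
      rw [Metric.mem_closedBall, not_le] at hx
      filter_upwards [tendsto_one_div_add_atTop_nhds_zero_nat.eventually_lt_const
        (sub_pos.2 hx)] with n hn
      refine ((u n).zero_of_le_dist ?_).symm
      show r + 1 / (n + 1 : ℝ) ≤ dist x c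
      linarith

/-- Fourier inversion: a finite measure with integrable characteristic function has the density
`invDensity μ`. -/
theorem eq_withDensity_invDensity (μ : Measure ℝ) [IsFiniteMeasure μ]
    (hμ : Integrable fun ξ : ℝ => charFun μ (2 * Real.pi * ξ)) :
    μ = volume.withDensity fun x => ENNReal.ofReal (invDensity μ x) := by
  have hcont := continuous_invDensity μ hμ
  have hloc : IsLocallyFiniteMeasure
      (volume.withDensity fun x => ENNReal.ofReal (invDensity μ x)) :=
    IsLocallyFiniteMeasure.withDensity_ofReal hcont
  refine Measure.ext_of_Icc _ _ fun a b hab => ?_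
  rw [Real.Icc_eq_closedBall]
  obtain ⟨u, hu⟩ := exists_bump_tendsto_measureReal_closedBall ((a + b) / 2) ((b - a) / 2)
    (by linarith)
  have h1 := hu μ inferInstance
  have h2 := hu _ hloc
  have h3 : ∀ n, ∫ x, u n x ∂μ =
      ∫ x, u n x ∂(volume.withDensity fun x => ENNReal.ofReal (invDensity μ x)) := by
    intro n
    rw [integral_contDiff_eq_integral_mul_invDensity μ hμ (u n).contDiff (u n).hasCompactSupport,
      integral_withDensity_eq_integral_toReal_smul (by fun_prop) (by simp)]
    refine integral_congr_ae (ae_of_all _ fun x => ?_)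
    simp [ENNReal.toReal_ofReal (invDensity_nonneg μ hμ x), mul_comm]
  simp_rw [h3] at h1
  have h4 := tendsto_nhds_unique h1 h2
  rwa [Measure.real, Measure.real, ENNReal.toReal_eq_toReal_iff' (by finiteness)
    (isCompact_closedBall _ _).measure_lt_top.ne] at h4

/-! ### The density of a symmetric stable law -/

theorem integrable_abs_pow_mul_exp_neg_mul_abs_rpow {α d : ℝ} (hα : 0 < α) (hd : 0 < d) (n : ℕ) :
    Integrable fun x : ℝ => |x| ^ n * Real.exp (-d * |x| ^ α) := by
  have h := integrableOn_rpow_mul_exp_neg_mul_rpow (s := (n : ℝ)) (p := α) (b := d)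
    (by linarith [Nat.cast_nonneg (α := ℝ) n]) hα hd
  rw [← integrable_indicator_iff measurableSet_Ioi] at h
  refine (h.add h.comp_neg).congr ?_
  have h0 : ∀ᵐ x : ℝ, x ≠ 0 := by simp [ae_iff]
  filter_upwards [h0] with x hx
  rcases lt_or_gt_of_ne hx with hx | hx
  · simp [Set.indicator, hx, hx.le, abs_of_neg hx]
  · simp [Set.indicator, hx, hx.le, abs_of_pos hx]

theorem IsStableLaw.charFun_two_pi {α d : ℝ} {μ : Measure ℝ} (hμ : IsStableLaw α d μ) (ξ : ℝ) :
    charFun μ (2 * Real.pi * ξ) =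
      ((Real.exp (-(d * (2 * Real.pi) ^ α) * |ξ| ^ α) : ℝ) : ℂ) := by
  rw [hμ.2, abs_mul, abs_of_pos Real.two_pi_pos,
    Real.mul_rpow Real.two_pi_pos.le (abs_nonneg _)]
  ring_nf

theorem IsStableLaw.integrable_pow_mul_charFun {α d : ℝ} {μ : Measure ℝ} (hμ : IsStableLaw α d μ)
    (hα : 0 < α) (hd : 0 < d) (n : ℕ) :
    Integrable fun ξ : ℝ => ‖ξ‖ ^ n * ‖charFun μ (2 * Real.pi * ξ)‖ := by
  simp only [hμ.charFun_two_pi, Complex.norm_real, Real.norm_eq_abs, Real.abs_exp]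
  exact integrable_abs_pow_mul_exp_neg_mul_abs_rpow hα (by positivity) n

theorem IsStableLaw.integrable_charFun {α d : ℝ} {μ : Measure ℝ} (hμ : IsStableLaw α d μ)
    (hα : 0 < α) (hd : 0 < d) : Integrable fun ξ : ℝ => charFun μ (2 * Real.pi * ξ) := by
  have := hμ.1
  have h := hμ.integrable_pow_mul_charFun hα hd 0
  simp only [pow_zero, one_mul] at h
  exact (integrable_norm_iff (measurable_charFun.comp (by fun_prop)).aestronglyMeasurable).1 h

theorem IsStableLaw.contDiff_invDensity {α d : ℝ} {μ : Measure ℝ} (hμ : IsStableLaw α d μ)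
    (hα : 0 < α) (hd : 0 < d) (N : ℕ) : ContDiff ℝ N (invDensity μ) := by
  have h := Real.contDiff_fourier (N := (N : ℕ∞)) fun n _ =>
    hμ.integrable_pow_mul_charFun hα hd n
  exact Complex.reCLM.contDiff.comp h

theorem IsStableLaw.map_mul {α d : ℝ} {μ : Measure ℝ} (hμ : IsStableLaw α d μ) {c : ℝ}
    (hc : 0 ≤ c) : IsStableLaw α (d * c ^ α) (μ.map fun x => c * x) := by
  have := hμ.1
  refine ⟨Measure.isProbabilityMeasure_map (by fun_prop), fun t => ?_⟩
  rw [charFun_map_mul, hμ.2, abs_mul, abs_of_nonneg hc, Real.mul_rpow hc (abs_nonneg _)]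
  ring_nf

theorem invDensity_map_mul (μ : Measure ℝ) {c : ℝ} (hc : 0 < c) (x : ℝ) :
    invDensity (μ.map fun x => c * x) x = c⁻¹ * invDensity μ (x / c) := by
  simp only [invDensity, charFun_map_mul, Real.fourier_real_eq_integral_exp_smul]
  have h := Measure.integral_comp_mul_left (fun v : ℝ => Complex.exp
    (↑(-2 * Real.pi * v * (x / c)) * Complex.I) • charFun μ (2 * Real.pi * v)) c
  rw [abs_of_pos (inv_pos.2 hc)] at h
  rw [← Complex.re_ofReal_mul, ← Complex.real_smul, ← h]
  congr 1
  refine integral_congr_ae (ae_of_all _ fun v => ?_)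
  have e1 : -2 * Real.pi * (c * v) * (x / c) = -2 * Real.pi * v * x := by field_simp
  have e2 : c * (2 * Real.pi * v) = 2 * Real.pi * (c * v) := by ring
  simp only [e1, e2]

/-- The density of a convolution: if the characteristic function of `ρ` is the product of those of
`μ` and `ν`, then the density of `ρ` averages translates of the density of `μ` over `ν`. -/
theorem invDensity_eq_integral_sub (μ ν ρ : Measure ℝ) [IsFiniteMeasure ν]
    (hμ : Integrable fun ξ : ℝ => charFun μ (2 * Real.pi * ξ))
    (hρ : ∀ t, charFun ρ t = charFun μ t * charFun ν t) (x : ℝ) :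
    invDensity ρ x = ∫ y, invDensity μ (x - y) ∂ν := by
  have hF : Continuous (𝓕 (fun ξ : ℝ => charFun μ (2 * Real.pi * ξ))) :=
    VectorFourier.fourierIntegral_continuous Real.continuous_fourierChar
      (L := innerₗ ℝ) (by simp only [innerₗ_apply_apply]; exact continuous_inner) hμ
  have hbd : ∀ y, ‖𝓕 (fun ξ : ℝ => charFun μ (2 * Real.pi * ξ)) y‖ ≤
      ∫ ξ, ‖charFun μ (2 * Real.pi * ξ)‖ := fun y =>
    VectorFourier.norm_fourierIntegral_le_integral_norm _ _ _ _ _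
  let g : ℝ → ℂ := fun ξ =>
    Complex.exp (↑(-2 * Real.pi * ξ * x) * Complex.I) * charFun μ (2 * Real.pi * ξ)
  have hg : Integrable g := by
    refine hμ.bdd_mul (c := 1) (by fun_prop) (ae_of_all _ fun ξ => ?_)
    rw [Complex.norm_exp_ofReal_mul_I]
  have h := integral_mul_charFun ν hg
  have e1 : ∀ y, 𝓕⁻ g y = 𝓕 (fun ξ : ℝ => charFun μ (2 * Real.pi * ξ)) (x - y) := by
    intro y
    rw [Real.fourierInv_eq', Real.fourier_real_eq_integral_exp_smul]
    refine integral_congr_ae (ae_of_all _ fun v => ?_)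
    simp only [g, smul_eq_mul, ← mul_assoc, ← Complex.exp_add]
    congr 2
    simp
    ring
  simp only [e1] at h
  have hi : Integrable (fun y => 𝓕 (fun ξ : ℝ => charFun μ (2 * Real.pi * ξ)) (x - y)) ν :=
    Integrable.of_bound (hF.comp (by fun_prop)).aestronglyMeasurable _
      (ae_of_all _ fun y => hbd (x - y))
  have h2 := integral_re (𝕜 := ℂ) hi
  simp only [RCLike.re_to_complex] at h2
  rw [← h] at h2
  simp only [invDensity]
  rw [h2, Real.fourier_real_eq_integral_exp_smul]
  congr 1
  refine integral_congr_ae (ae_of_all _ fun v => ?_)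
  simp only [g, smul_eq_mul, hρ, mul_assoc]

theorem IsStableLaw.invDensity_neg {α d : ℝ} {μ : Measure ℝ} (hμ : IsStableLaw α d μ) (x : ℝ) :
    invDensity μ (-x) = invDensity μ x := by
  simp only [invDensity, Real.fourier_real_eq_integral_exp_smul]
  rw [← integral_neg_eq_self]
  congr 1
  refine integral_congr_ae (ae_of_all _ fun v => ?_)
  simp only [hμ.charFun_two_pi, abs_neg]
  simp only [mul_neg, neg_mul, neg_neg]

theorem IsStableLaw.invDensity_zero_pos {α d : ℝ} {μ : Measure ℝ} (hμ : IsStableLaw α d μ)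
    (hα : 0 < α) (hd : 0 < d) : 0 < invDensity μ 0 := by
  have hi := hμ.integrable_charFun hα hd
  have h2 := integral_re (𝕜 := ℂ) hi
  simp only [invDensity, Real.fourier_real_eq_integral_exp_smul]
  simp only [mul_zero, Complex.ofReal_zero, zero_mul, Complex.exp_zero, one_smul]
  simp only [RCLike.re_to_complex] at h2
  rw [← h2]
  simp only [hμ.charFun_two_pi, Complex.ofReal_re] at hi ⊢
  refine integral_pos_of_integrable_nonneg_nonzero (x := 0) ?_ hi.re ?_ (Real.exp_pos _).ne'
  · have : Continuous fun x : ℝ => |x| ^ α :=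
      continuous_abs.rpow_const fun _ => Or.inr hα.le
    fun_prop
  · exact fun x => (Real.exp_pos _).le

/-- The law `S(α, 1)` is that of `s X + t Y` with `X`, `Y` independent copies and
`s ^ α + t ^ α = 1`, so the set where its density is positive is closed under `s u + t v`. -/
theorem IsStableLaw.invDensity_pos_combination {α : ℝ} {μ : Measure ℝ} (hμ : IsStableLaw α 1 μ)
    (hα : 0 < α) {s t u v : ℝ} (hs : 0 < s) (ht : 0 < t) (hst : s ^ α + t ^ α = 1)
    (hu : 0 < invDensity μ u) (hv : 0 < invDensity μ v) :
    0 < invDensity μ (s * u + t * v) := by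
  have := hμ.1
  have hμs := hμ.map_mul hs.le
  have hμt := hμ.map_mul ht.le
  have hint := hμ.integrable_charFun hα one_pos
  have hcont := continuous_invDensity μ hint
  have hconv := invDensity_eq_integral_sub (μ.map fun x => s * x) (μ.map fun x => t * x) μ
    (hμs.integrable_charFun hα (by positivity)) (fun ξ => by
      rw [hμs.2, hμt.2, hμ.2, ← Complex.ofReal_mul, ← Real.exp_add]
      congr 2
      linear_combination |ξ| ^ α * hst) (s * u + t * v)
  have hcs := continuous_invDensity _ (hμs.integrable_charFun hα (by positivity))
  have hcs' : Continuous fun y => invDensity (μ.map fun x => s * x) (s * u + t * v - y) := by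
    fun_prop
  rw [integral_map (by fun_prop) hcs'.aestronglyMeasurable] at hconv
  rw [hconv]
  simp only [invDensity_map_mul μ hs]
  have hbd : ∀ y, ‖invDensity μ y‖ ≤ ∫ ξ, ‖charFun μ (2 * Real.pi * ξ)‖ := fun y =>
    (Complex.abs_re_le_norm _).trans
      (VectorFourier.norm_fourierIntegral_le_integral_norm _ _ _ _ _)
  have hmeas : Measurable fun x => ENNReal.ofReal (invDensity μ x) := by fun_prop
  have hfi : Integrable (invDensity μ) := by
    have h := integrable_withDensity_iff_integrable_smul' (μ := volume) hmeas
      (ae_of_all _ fun x => ENNReal.ofReal_lt_top) (g := fun _ : ℝ => (1 : ℝ))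
    rw [← eq_withDensity_invDensity μ hint] at h
    refine (h.1 (integrable_const _)).congr (ae_of_all _ fun x => ?_)
    simp [ENNReal.toReal_ofReal (invDensity_nonneg μ hint x)]
  rw [eq_withDensity_invDensity μ hint,
    integral_withDensity_eq_integral_toReal_smul hmeas
      (ae_of_all _ fun x => ENNReal.ofReal_lt_top), ← eq_withDensity_invDensity μ hint]
  simp only [ENNReal.toReal_ofReal (invDensity_nonneg μ hint _), smul_eq_mul]
  refine integral_pos_of_integrable_nonneg_nonzero (x := v) (by fun_prop) ?_ ?_ ?_
  · refine hfi.mul_bdd (c := s⁻¹ * ∫ ξ, ‖charFun μ (2 * Real.pi * ξ)‖)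
      (by fun_prop) (ae_of_all _ fun y => ?_)
    rw [norm_mul, Real.norm_of_nonneg (inv_pos.2 hs).le]
    gcongr
    exact hbd _
  · intro y
    have := invDensity_nonneg μ hint y
    have := invDensity_nonneg μ hint ((s * u + t * v - t * y) / s)
    simp only [Pi.zero_apply]
    positivity
  · have : (s * u + t * v - t * v) / s = u := by field_simp; ring
    rw [this]
    positivity

theorem one_sub_charFun_re_le {μ : Measure ℝ} [IsProbabilityMeasure μ] {R : ℝ}
    (hR : ∀ᵐ x ∂μ, |x| ≤ R) (t : ℝ) : 1 - (charFun μ t).re ≤ t ^ 2 * R ^ 2 / 2 := by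
  have hi : Integrable (fun x : ℝ => Complex.exp (t * x * Complex.I)) μ :=
    Integrable.of_bound (by fun_prop) 1 (ae_of_all _ fun x => by
      rw [← Complex.ofReal_mul, Complex.norm_exp_ofReal_mul_I])
  have h1 : (charFun μ t).re = ∫ x, Real.cos (t * x) ∂μ := by
    rw [charFun_apply_real]
    refine (integral_re (𝕜 := ℂ) hi).symm.trans (integral_congr_ae (ae_of_all _ fun x => ?_))
    simp only [RCLike.re_to_complex]
    rw [← Complex.ofReal_mul, Complex.exp_ofReal_mul_I_re]
  have h2 : ∫ x, (1 - t ^ 2 * R ^ 2 / 2) ∂μ ≤ ∫ x, Real.cos (t * x) ∂μ := by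
    refine integral_mono_ae (integrable_const _) ?_ ?_
    · exact Integrable.of_bound (by fun_prop) 1 (ae_of_all _ fun x => Real.abs_cos_le_one _)
    · filter_upwards [hR] with x hx
      have h3 : x ^ 2 ≤ R ^ 2 := sq_le_sq' (by linarith [abs_le.1 hx]) (abs_le.1 hx).2
      have h4 := Real.one_sub_sq_div_two_le_cos (x := t * x)
      nlinarith [mul_le_mul_of_nonneg_left h3 (sq_nonneg t)]
  simp only [integral_const, probReal_univ, one_smul] at h2
  linarith

/-- The density of `S(α, 1)` is positive everywhere. The set `U` where it is positive is star-shaped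
about `0`, so a zero makes `U` bounded. For `α < 2` that contradicts the order `|t| ^ α` of the
characteristic function at `0`, and for `α = 2` the set `U` is stable under multiplication
by `√2`. -/
theorem IsStableLaw.invDensity_pos {α : ℝ} {μ : Measure ℝ} (hμ : IsStableLaw α 1 μ)
    (hα : 0 < α) (hα2 : α ≤ 2) (x : ℝ) : 0 < invDensity μ x := by
  have := hμ.1
  have hint := hμ.integrable_charFun hα one_pos
  have hcont := continuous_invDensity μ hint
  have h0 := hμ.invDensity_zero_pos hα one_pos
  by_contra! hx
  have hsymm : ∀ y, invDensity μ |y| = invDensity μ y := fun y => by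
    rcases abs_choice y with h | h <;> rw [h]
    exact hμ.invDensity_neg y
  rw [← hsymm x] at hx
  have hxpos : 0 < |x| := by
    rcases (abs_nonneg x).eq_or_lt with h | h
    · rw [← h] at hx; linarith
    · exact h
  have hbound : ∀ u, 0 < invDensity μ u → |u| ≤ |x| := by
    intro u hu
    by_contra! hlt
    have hupos : 0 < |u| := hxpos.trans hlt
    set s := |x| / |u| with hs
    have hs0 : 0 < s := by positivity
    have hs1 : s < 1 := (div_lt_one hupos).2 hlt
    have hsα : s ^ α < 1 := Real.rpow_lt_one hs0.le hs1 hα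
    -- `|x| = s |u| + t 0` with `t` chosen so that `s ^ α + t ^ α = 1`
    have h := hμ.invDensity_pos_combination hα (s := s) (t := (1 - s ^ α) ^ (α⁻¹))
      (u := |u|) (v := 0) hs0 (Real.rpow_pos_of_pos (by linarith) _)
      (by rw [Real.rpow_inv_rpow (by linarith) hα.ne']; ring) (by rwa [hsymm]) h0
    have e : s * |u| + (1 - s ^ α) ^ (α⁻¹) * 0 = |x| := by rw [hs]; field_simp; ring
    rw [e] at h
    linarith
  rcases hα2.lt_or_eq with hlt | rfl
  · -- bounded support makes `1 - exp (-t ^ α)`, which is at least `t ^ α / 2`, of order `t ^ 2`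
    have hae : ∀ᵐ y ∂μ, |y| ≤ |x| := by
      rw [eq_withDensity_invDensity μ hint, ae_withDensity_iff (by fun_prop)]
      refine ae_of_all _ fun y hy => hbound y ?_
      by_contra! h
      exact hy (ENNReal.ofReal_eq_zero.2 h)
    have key : ∀ t : ℝ, 0 < t → t ≤ 1 → t ^ (α - 2) ≤ x ^ 2 := by
      intro t ht ht1
      have h1 := one_sub_charFun_re_le hae t
      rw [hμ.2, Complex.ofReal_re, abs_of_pos ht, sq_abs] at h1
      have hy0 : 0 < t ^ α := Real.rpow_pos_of_pos ht α
      have hy1 : t ^ α ≤ 1 := Real.rpow_le_one ht.le ht1 hα.le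
      have h2 : Real.exp (-1 * t ^ α) ≤ 1 - t ^ α / 2 := by
        have h3 := Real.add_one_le_exp (t ^ α)
        have h4 : Real.exp (-1 * t ^ α) * Real.exp (t ^ α) = 1 := by
          rw [← Real.exp_add]; simp
        have h5 := Real.exp_pos (-1 * t ^ α)
        have h6 : Real.exp (-1 * t ^ α) * (1 + t ^ α) ≤ 1 := by nlinarith
        have h7 : 1 ≤ (1 - t ^ α / 2) * (1 + t ^ α) := by nlinarith
        exact le_of_mul_le_mul_right (h6.trans h7) (by linarith)
      rw [Real.rpow_sub ht, Real.rpow_two, div_le_iff₀ (by positivity)]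
      nlinarith
    have htend : Tendsto (fun t : ℝ => t ^ (α - 2)) (𝓝[>] 0) atTop :=
      tendsto_rpow_neg_nhdsGT_zero (by linarith)
    have hev := htend.eventually_gt_atTop (x ^ 2)
    have hev2 : ∀ᶠ t : ℝ in 𝓝[>] 0, t ∈ Set.Ioc (0 : ℝ) 1 := Ioc_mem_nhdsGT one_pos
    obtain ⟨t, h1, h2⟩ := (hev.and hev2).exists
    exact absurd (key t h2.1 h2.2) (not_le.2 h1)
  · obtain ⟨u₀, hu₀, hu₀pos⟩ : ∃ u₀, 0 < invDensity μ u₀ ∧ 0 < u₀ := by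
      have h1 := (hcont.continuousAt (x := 0)).eventually_const_lt h0
      have h2 := (h1.filter_mono nhdsWithin_le_nhds).and (self_mem_nhdsWithin (s := Set.Ioi 0))
      exact h2.exists
    have hstep : ∀ n : ℕ, 0 < invDensity μ (√2 ^ n * u₀) := by
      intro n
      induction n with
      | zero => simpa using hu₀
      | succ n ih =>
        have hsq : (√2 : ℝ) ^ 2 = 2 := Real.sq_sqrt (by norm_num)
        have h := hμ.invDensity_pos_combination hα (s := √2 / 2) (t := √2 / 2) (by positivity)
          (by positivity) (by rw [Real.rpow_two, div_pow, hsq]; norm_num) ih ih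
        convert h using 2
        ring
    have htend : Tendsto (fun n : ℕ => √2 ^ n * u₀) atTop atTop :=
      (tendsto_pow_atTop_atTop_of_one_lt (by
        rw [Real.lt_sqrt (by norm_num)]; norm_num)).atTop_mul_const hu₀pos
    obtain ⟨n, hn⟩ := (htend.eventually_gt_atTop |x|).exists
    have := hbound _ (hstep n)
    exact absurd ((le_abs_self _).trans this) (not_le.2 hn)

/-! ### Distribution functions of `S(α, 1)` and of its absolute value -/

theorem hasDerivAt_cdf_invDensity (μ : Measure ℝ) [IsProbabilityMeasure μ]
    (hμ : Integrable fun ξ : ℝ => charFun μ (2 * Real.pi * ξ)) (x : ℝ) :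
    HasDerivAt (cdf μ) (invDensity μ x) x := by
  have hcont := continuous_invDensity μ hμ
  have hnn := invDensity_nonneg μ hμ
  have hreal : ∀ a b, a ≤ b → cdf μ b - cdf μ a = ∫ y in a..b, invDensity μ y := by
    intro a b hab
    have h1 : (cdf μ).measure (Set.Ioc a b) = μ (Set.Ioc a b) := by rw [measure_cdf]
    rw [StieltjesFunction.measure_Ioc, eq_withDensity_invDensity μ hμ,
      withDensity_apply _ measurableSet_Ioc,
      ← ofReal_integral_eq_lintegral_ofReal
        ((hcont.integrableOn_Icc (a := a) (b := b)).mono_set Set.Ioc_subset_Icc_self)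
        (ae_of_all _ hnn), ← eq_withDensity_invDensity μ hμ] at h1
    rw [intervalIntegral.integral_of_le hab]
    exact (ENNReal.ofReal_eq_ofReal_iff (sub_nonneg.2 (monotone_cdf μ hab))
      (integral_nonneg hnn)).1 h1
  have heq : ∀ y, cdf μ y = cdf μ x + ∫ z in x..y, invDensity μ z := by
    intro y
    rcases le_total x y with h | h
    · rw [← hreal x y h]; ring
    · rw [intervalIntegral.integral_symm, ← hreal y x h]; ring
  have h2 : HasDerivAt (fun y => cdf μ x + ∫ z in x..y, invDensity μ z) (invDensity μ x) x :=
    (intervalIntegral.integral_hasDerivAt_right (hcont.intervalIntegrable _ _)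
      (hcont.stronglyMeasurableAtFilter _ _) hcont.continuousAt).const_add _
  exact h2.congr_of_eventuallyEq (Eventually.of_forall heq)

theorem cdf_map_abs_of_neg (μ : Measure ℝ) [IsProbabilityMeasure μ] {t : ℝ} (ht : t < 0) :
    cdf (μ.map fun x => |x|) t = 0 := by
  have := Measure.isProbabilityMeasure_map (μ := μ) (f := fun x : ℝ => |x|) (by fun_prop)
  rw [cdf_eq_real, map_measureReal_apply (by fun_prop) measurableSet_Iic]
  have : (fun x : ℝ => |x|) ⁻¹' Set.Iic t = ∅ := by
    ext x
    simpa using ht.trans_le (abs_nonneg x)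
  simp [this]

namespace IsStableLaw

variable {α d : ℝ} {μ : Measure ℝ}

theorem hasDerivAt_cdf (hμ : IsStableLaw α d μ) (hα : 0 < α) (hd : 0 < d) (x : ℝ) :
    HasDerivAt (cdf μ) (invDensity μ x) x :=
  have := hμ.1
  hasDerivAt_cdf_invDensity μ (hμ.integrable_charFun hα hd) x

theorem continuous_cdf (hμ : IsStableLaw α d μ) (hα : 0 < α) (hd : 0 < d) :
    Continuous (cdf μ) :=
  continuous_iff_continuousAt.2 fun x => (hμ.hasDerivAt_cdf hα hd x).continuousAt

theorem contDiff_cdf (hμ : IsStableLaw α d μ) (hα : 0 < α) (hd : 0 < d) (n : ℕ) :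
    ContDiff ℝ (n + 1) (cdf μ) := by
  rw [contDiff_succ_iff_deriv]
  refine ⟨fun x => (hμ.hasDerivAt_cdf hα hd x).differentiableAt, by simp, ?_⟩
  rw [show deriv (cdf μ) = invDensity μ from funext fun x => (hμ.hasDerivAt_cdf hα hd x).deriv]
  exact hμ.contDiff_invDensity hα hd n

theorem strictMono_cdf (hμ : IsStableLaw α 1 μ) (hα : 0 < α) (hα2 : α ≤ 2) :
    StrictMono (cdf μ) :=
  strictMono_of_hasDerivAt_pos (fun x => hμ.hasDerivAt_cdf hα one_pos x)
    fun x => hμ.invDensity_pos hα hα2 x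

theorem map_neg (hμ : IsStableLaw α d μ) : μ.map (fun x => -x) = μ := by
  have := hμ.1
  have h : IsStableLaw α d (μ.map fun x => -x) := by
    refine ⟨Measure.isProbabilityMeasure_map (by fun_prop), fun t => ?_⟩
    have h1 := charFun_map_mul (μ := μ) (-1) t
    simp only [neg_mul, one_mul] at h1
    rw [h1, hμ.2, abs_neg]
  exact h.unique hμ

theorem nullSingletonClass (hμ : IsStableLaw α d μ) (hα : 0 < α) (hd : 0 < d) :
    NullSingletonClass μ := by
  have := hμ.1
  have h := withDensity_absolutelyContinuous volume
    fun x => ENNReal.ofReal (invDensity μ x)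
  rw [← eq_withDensity_invDensity μ (hμ.integrable_charFun hα hd)] at h
  exact ⟨fun x => h (measure_singleton x)⟩

theorem cdf_neg (hμ : IsStableLaw α d μ) (hα : 0 < α) (hd : 0 < d) (x : ℝ) :
    cdf μ (-x) = 1 - cdf μ x := by
  have := hμ.1
  have := hμ.nullSingletonClass hα hd
  rw [cdf_eq_real, cdf_eq_real, ← probReal_compl_eq_one_sub measurableSet_Iic, Set.compl_Iic]
  conv_lhs => rw [← hμ.map_neg]
  rw [map_measureReal_apply (by fun_prop) measurableSet_Iic]
  have : (fun x : ℝ => -x) ⁻¹' Set.Iic (-x) = Set.Ici x := by ext y; simp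
  rw [this]
  exact measureReal_congr Ioi_ae_eq_Ici.symm

theorem cdf_abs (hμ : IsStableLaw α d μ) (hα : 0 < α) (hd : 0 < d) {t : ℝ} (ht : 0 ≤ t) :
    cdf (μ.map fun x => |x|) t = 2 * cdf μ t - 1 := by
  have := hμ.1
  have := hμ.nullSingletonClass hα hd
  have := Measure.isProbabilityMeasure_map (μ := μ) (f := fun x : ℝ => |x|) (by fun_prop)
  rw [cdf_eq_real, map_measureReal_apply (by fun_prop) measurableSet_Iic]
  have h1 : (fun x : ℝ => |x|) ⁻¹' Set.Iic t = Set.Icc (-t) t := by ext y; simp [abs_le]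
  have h2 : μ.real (Set.Icc (-t) t) = μ.real (Set.Ioc (-t) t) :=
    measureReal_congr Ioc_ae_eq_Icc.symm
  have h3 : μ.real (Set.Ioc (-t) t) = cdf μ t - cdf μ (-t) := by
    rw [← Set.Iic_sdiff_Iic, measureReal_sdiff (Set.Iic_subset_Iic.2 (by linarith))
      measurableSet_Iic, cdf_eq_real, cdf_eq_real]
  rw [h1, h2, h3, hμ.cdf_neg hα hd]
  ring

theorem cdf_abs_scale (hμ : IsStableLaw α d μ) {c : ℝ} (hc : 0 < c) (t : ℝ) :
    (μ.map fun x => c * x).real {x | |x| ≤ t} = cdf (μ.map fun x => |x|) (t / c) := by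
  have := hμ.1
  have := Measure.isProbabilityMeasure_map (μ := μ) (f := fun x : ℝ => |x|) (by fun_prop)
  have hm : MeasurableSet {x : ℝ | |x| ≤ t} := measurableSet_le (by fun_prop) (by fun_prop)
  rw [cdf_eq_real, map_measureReal_apply (by fun_prop) measurableSet_Iic,
    map_measureReal_apply (by fun_prop) hm]
  congr 1
  ext x
  simp only [Set.mem_preimage, Set.mem_ofPred_eq, Set.mem_Iic, abs_mul, abs_of_pos hc]
  rw [le_div_iff₀ hc, mul_comm]

theorem cdf_zero (hμ : IsStableLaw α d μ) (hα : 0 < α) (hd : 0 < d) : cdf μ 0 = 1 / 2 := by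
  have := hμ.cdf_neg hα hd 0
  rw [neg_zero] at this
  linarith

/-- The tail of `|X|` is `O(t ^ (-α))`, because the characteristic function differs from `1` by at
most `|t| ^ α`. -/
theorem one_sub_cdf_abs_le (hμ : IsStableLaw α 1 μ) (hα : 0 < α) {t : ℝ} (ht : 0 < t) :
    1 - cdf (μ.map fun x => |x|) t ≤ 2 * (2 / t) ^ α := by
  have := hμ.1
  have := Measure.isProbabilityMeasure_map (μ := μ) (f := fun x : ℝ => |x|) (by fun_prop)
  have h1 := measureReal_abs_gt_le_integral_charFun (μ := μ) ht
  have h2 : ‖∫ s in (-2 * t⁻¹)..(2 * t⁻¹), 1 - charFun μ s‖ ≤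
      (2 / t) ^ α * |2 * t⁻¹ - -2 * t⁻¹| := by
    refine intervalIntegral.norm_integral_le_of_norm_le_const fun s hs => ?_
    rw [Set.uIoc_of_le (by have := inv_pos.2 ht; linarith)] at hs
    have hs' : |s| ≤ 2 / t := by
      rw [div_eq_mul_inv, abs_le]
      exact ⟨by linarith [hs.1], hs.2⟩
    rw [hμ.2, ← Complex.ofReal_one, ← Complex.ofReal_sub, Complex.norm_real]
    have h3 := Real.add_one_le_exp (-1 * |s| ^ α)
    have h4 : Real.exp (-1 * |s| ^ α) ≤ 1 := by
      rw [Real.exp_le_one_iff]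
      have := Real.rpow_nonneg (abs_nonneg s) α
      linarith
    rw [Real.norm_of_nonneg (by linarith)]
    have h5 : |s| ^ α ≤ (2 / t) ^ α := Real.rpow_le_rpow (abs_nonneg s) hs' hα.le
    linarith
  have h3 : 1 - cdf (μ.map fun x => |x|) t = μ.real {x | t < |x|} := by
    rw [cdf_eq_real, ← probReal_compl_eq_one_sub measurableSet_Iic,
      map_measureReal_apply (by fun_prop) measurableSet_Iic.compl]
    congr 1
    ext x
    simp
  rw [h3]
  refine h1.trans ((mul_le_mul_of_nonneg_left h2 (by positivity)).trans_eq ?_)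
  have : (0 : ℝ) < t⁻¹ := inv_pos.2 ht
  rw [abs_of_pos (by linarith)]
  field_simp
  ring

end IsStableLaw

/-! ### Order statistics of a uniform sample: the Beta law and its moments -/

/-- The density on `[0, 1]` of the `(ν + 1)`-st smallest of `n + 1` independent uniform variables,
which is `n + 1` times a Bernstein polynomial. -/
noncomputable def orderDensity (n ν : ℕ) (u : ℝ) : ℝ :=
  (n + 1) * ((n.choose ν : ℝ) * u ^ ν * (1 - u) ^ (n - ν))

/-- The probability that a binomial variable with parameters `n` and `p` is at least `m`. -/
noncomputable def binomialTail (n m : ℕ) (p : ℝ) : ℝ :=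
  ∑ j ∈ Finset.Ico m (n + 1), (n.choose j : ℝ) * p ^ j * (1 - p) ^ (n - j)

/-- The law of the `(ν + 1)`-st smallest of `n + 1` independent uniform variables. -/
noncomputable def orderLaw (n ν : ℕ) : Measure ℝ :=
  (volume.restrict (Set.Ioc 0 1)).withDensity fun u => ENNReal.ofReal (orderDensity n ν u)

theorem continuous_orderDensity (n ν : ℕ) : Continuous (orderDensity n ν) := by
  unfold orderDensity
  fun_prop

theorem orderDensity_nonneg (n ν : ℕ) {u : ℝ} (h0 : 0 ≤ u) (h1 : u ≤ 1) :
    0 ≤ orderDensity n ν u := by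
  have : 0 ≤ 1 - u := by linarith
  unfold orderDensity
  positivity

/-- The derivatives of Bernstein polynomials telescope. -/
theorem hasDerivAt_binomialTail (n ν : ℕ) (hν : ν ≤ n) (p : ℝ) :
    HasDerivAt (binomialTail (n + 1) (ν + 1)) (orderDensity n ν p) p := by
  have h1 : binomialTail (n + 1) (ν + 1) = fun p =>
      (∑ i ∈ Finset.Ico ν (n + 1), bernsteinPolynomial ℝ (n + 1) (i + 1)).eval p := by
    funext p
    rw [binomialTail, Polynomial.eval_finsetSum, ← Finset.sum_Ico_add' _ ν (n + 1) 1]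
    simp [bernsteinPolynomial]
  rw [h1]
  refine (Polynomial.hasDerivAt _ p).congr_deriv ?_
  rw [Polynomial.derivative_sum]
  simp only [bernsteinPolynomial.derivative_succ, Nat.add_sub_cancel]
  rw [← Finset.mul_sum]
  have h2 : ∀ i, bernsteinPolynomial ℝ n i - bernsteinPolynomial ℝ n (i + 1) =
      -(bernsteinPolynomial ℝ n (i + 1) - bernsteinPolynomial ℝ n i) := fun i => by ring
  simp only [h2]
  rw [Finset.sum_neg_distrib, Finset.sum_Ico_sub (bernsteinPolynomial ℝ n) (by omega),
    bernsteinPolynomial.eq_zero_of_lt ℝ (Nat.lt_succ_self n)]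
  simp [orderDensity, bernsteinPolynomial]

theorem binomialTail_zero (n ν : ℕ) : binomialTail n (ν + 1) 0 = 0 := by
  refine Finset.sum_eq_zero fun j hj => ?_
  have : j ≠ 0 := by have := (Finset.mem_Ico.1 hj).1; omega
  simp [this]

theorem binomialTail_one (n m : ℕ) (hm : m ≤ n) : binomialTail n m 1 = 1 := by
  rw [binomialTail, Finset.sum_eq_single n]
  · simp
  · intro j hj hne
    have : n - j ≠ 0 := by have := (Finset.mem_Ico.1 hj).2; omega
    simp [this]
  · intro h
    exact absurd (Finset.mem_Ico.2 ⟨hm, by omega⟩) h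

theorem integral_orderDensity (n ν : ℕ) (hν : ν ≤ n) (u : ℝ) :
    ∫ x in (0 : ℝ)..u, orderDensity n ν x = binomialTail (n + 1) (ν + 1) u := by
  rw [intervalIntegral.integral_eq_sub_of_hasDerivAt
    (fun x _ => hasDerivAt_binomialTail n ν hν x)
    ((continuous_orderDensity n ν).intervalIntegrable _ _), binomialTail_zero, sub_zero]

theorem integral_orderDensity_one (n ν : ℕ) (hν : ν ≤ n) :
    ∫ x in (0 : ℝ)..1, orderDensity n ν x = 1 := by
  rw [integral_orderDensity n ν hν, binomialTail_one _ _ (by omega)]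

/-- Multiplication by `u` raises both the sample size and the rank by one. -/
theorem mul_orderDensity (n ν : ℕ) (u : ℝ) :
    u * orderDensity n ν u = ((ν : ℝ) + 1) / (n + 2) * orderDensity (n + 1) (ν + 1) u := by
  have h : ((n : ℝ) + 1) * n.choose ν = (n + 1).choose (ν + 1) * (ν + 1) := by
    exact_mod_cast Nat.add_one_mul_choose_eq n ν
  have h2 : n + 1 - (ν + 1) = n - ν := by omega
  unfold orderDensity
  rw [h2, div_mul_eq_mul_div, eq_div_iff (by positivity)]
  push_cast
  linear_combination (u * u ^ ν * (1 - u) ^ (n - ν)) * (n + 2) * h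

/-- Multiplication by `1 - u` raises the sample size and keeps the rank. -/
theorem orderDensity_succ (n ν : ℕ) (hν : ν ≤ n) (u : ℝ) :
    orderDensity (n + 1) ν u =
      (1 - u) * (((n : ℝ) + 2) / (n + 1 - ν) * orderDensity n ν u) := by
  have h : ((n + 1).choose ν : ℝ) * (n + 1 - ν) = n.choose ν * (n + 1) := by
    have := Nat.choose_mul_succ_eq n ν
    have h3 : ((n + 1 - ν : ℕ) : ℝ) = n + 1 - ν := by
      rw [Nat.cast_sub (by omega)]; push_cast; ring
    rw [← h3]
    exact_mod_cast this.symm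
  have h2 : n + 1 - ν = n - ν + 1 := by omega
  have hpos : (0 : ℝ) < n + 1 - ν := by
    have : (ν : ℝ) ≤ n := by exact_mod_cast hν
    linarith
  unfold orderDensity
  rw [h2, mul_comm (1 - u), div_mul_eq_mul_div, div_mul_eq_mul_div, eq_div_iff hpos.ne']
  push_cast
  linear_combination (n + 2) * (u ^ ν * (1 - u) ^ (n - ν) * (1 - u)) * h

/-- The moments of the Beta law, as a product of successive ratios. -/
theorem integral_pow_mul_orderDensity (n ν : ℕ) (hν : ν ≤ n) (j : ℕ) :
    ∫ u in (0 : ℝ)..1, u ^ j * orderDensity n ν u =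
      ∏ i ∈ Finset.range j, ((ν : ℝ) + 1 + i) / (n + 2 + i) := by
  induction j generalizing n ν with
  | zero => simp [integral_orderDensity_one n ν hν]
  | succ j ih =>
    have h1 : ∀ u : ℝ, u ^ (j + 1) * orderDensity n ν u =
        ((ν : ℝ) + 1) / (n + 2) * (u ^ j * orderDensity (n + 1) (ν + 1) u) := fun u => by
      rw [pow_succ, mul_assoc, mul_orderDensity]; ring
    simp only [h1]
    rw [intervalIntegral.integral_const_mul, ih (n + 1) (ν + 1) (by omega),
      Finset.prod_range_succ', mul_comm]
    push_cast
    congr 1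
    · refine Finset.prod_congr rfl fun i _ => ?_
      congr 1 <;> ring
    · simp

theorem integral_orderLaw (n ν : ℕ) (f : ℝ → ℝ) :
    ∫ u, f u ∂(orderLaw n ν) = ∫ u in (0 : ℝ)..1, f u * orderDensity n ν u := by
  have hm : Measurable fun u => ENNReal.ofReal (orderDensity n ν u) :=
    (continuous_orderDensity n ν).measurable.ennreal_ofReal
  rw [orderLaw, integral_withDensity_eq_integral_toReal_smul hm
    (ae_of_all _ fun _ => ENNReal.ofReal_lt_top), intervalIntegral.integral_of_le zero_le_one]
  refine setIntegral_congr_fun measurableSet_Ioc fun u hu => ?_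
  simp only [smul_eq_mul]
  rw [ENNReal.toReal_ofReal (orderDensity_nonneg n ν hu.1.le hu.2), mul_comm]

theorem integrable_orderLaw_iff (n ν : ℕ) (f : ℝ → ℝ) :
    Integrable f (orderLaw n ν) ↔
      IntegrableOn (fun u => f u * orderDensity n ν u) (Set.Ioc 0 1) := by
  have hm : Measurable fun u => ENNReal.ofReal (orderDensity n ν u) :=
    (continuous_orderDensity n ν).measurable.ennreal_ofReal
  rw [orderLaw, integrable_withDensity_iff_integrable_smul' hm
    (ae_of_all _ fun _ => ENNReal.ofReal_lt_top)]
  refine integrable_congr ?_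
  filter_upwards [ae_restrict_mem measurableSet_Ioc] with u hu
  simp only [smul_eq_mul]
  rw [ENNReal.toReal_ofReal (orderDensity_nonneg n ν hu.1.le hu.2), mul_comm]

theorem orderLaw_Iic (n ν : ℕ) (hν : ν ≤ n) {u : ℝ} (h0 : 0 ≤ u) (h1 : u ≤ 1) :
    orderLaw n ν (Set.Iic u) = ENNReal.ofReal (binomialTail (n + 1) (ν + 1) u) := by
  rw [orderLaw, withDensity_apply _ measurableSet_Iic, Measure.restrict_restrict measurableSet_Iic]
  have : Set.Iic u ∩ Set.Ioc 0 1 = Set.Ioc 0 u := by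
    ext x
    simp only [Set.mem_inter_iff, Set.mem_Iic, Set.mem_Ioc]
    constructor
    · rintro ⟨a, b, -⟩; exact ⟨b, a⟩
    · rintro ⟨a, b⟩; exact ⟨b, a, b.trans h1⟩
  rw [this, ← ofReal_integral_eq_lintegral_ofReal, ← integral_orderDensity n ν hν,
    intervalIntegral.integral_of_le h0]
  · exact ((continuous_orderDensity n ν).integrableOn_Icc).mono_set Set.Ioc_subset_Icc_self
  · filter_upwards [ae_restrict_mem measurableSet_Ioc] with x hx
    exact orderDensity_nonneg n ν hx.1.le (hx.2.trans h1)

theorem orderLaw_compl (n ν : ℕ) : orderLaw n ν (Set.Ioc 0 1)ᶜ = 0 := by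
  refine withDensity_absolutelyContinuous _ _ ?_
  rw [Measure.restrict_apply measurableSet_Ioc.compl]
  simp

theorem isProbabilityMeasure_orderLaw (n ν : ℕ) (hν : ν ≤ n) :
    IsProbabilityMeasure (orderLaw n ν) := by
  constructor
  have h : orderLaw n ν Set.univ = orderLaw n ν (Set.Iic 1) := by
    refine le_antisymm ?_ (measure_mono (Set.subset_univ _))
    have : (Set.univ : Set ℝ) ⊆ Set.Iic 1 ∪ (Set.Ioc 0 1)ᶜ := by
      intro x _
      by_cases hx : x ≤ 1
      · exact Or.inl hx
      · exact Or.inr fun h => hx h.2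
    calc _ ≤ _ := measure_mono this
      _ ≤ _ := measure_union_le _ _
      _ = _ := by rw [orderLaw_compl, add_zero]
  rw [h, orderLaw_Iic n ν hν zero_le_one le_rfl, binomialTail_one _ _ (by omega),
    ENNReal.ofReal_one]

theorem integrable_orderLaw_of_continuous (n ν : ℕ) {f : ℝ → ℝ} (hf : Continuous f) :
    Integrable f (orderLaw n ν) := by
  rw [integrable_orderLaw_iff]
  exact (hf.mul (continuous_orderDensity n ν)).integrableOn_Icc.mono_set Set.Ioc_subset_Icc_self

/-- Dividing by `(1 - u) ^ 2` turns the Beta density with sample size `n + 3` into a multiple of the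
one with sample size `n + 1`. -/
theorem integral_div_orderLaw (n ν : ℕ) (hν : ν ≤ n) {f : ℝ → ℝ} (hf : Continuous f) :
    Integrable (fun u => f u / (1 - u) ^ 2) (orderLaw (n + 2) ν) ∧
    ∫ u, f u / (1 - u) ^ 2 ∂(orderLaw (n + 2) ν) =
      ((n : ℝ) + 2) * (n + 3) / ((n + 1 - ν) * (n + 2 - ν)) * ∫ u, f u ∂(orderLaw n ν) := by
  set c : ℝ := ((n : ℝ) + 2) * (n + 3) / ((n + 1 - ν) * (n + 2 - ν)) with hc
  have key : ∀ᵐ u : ℝ, f u / (1 - u) ^ 2 * orderDensity (n + 2) ν u =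
      c * (f u * orderDensity n ν u) := by
    have h1 : ∀ᵐ u : ℝ, u ≠ 1 := by simp [ae_iff]
    filter_upwards [h1] with u hu
    have hu' : 1 - u ≠ 0 := sub_ne_zero.2 hu.symm
    have hp : (ν : ℝ) ≤ n := by exact_mod_cast hν
    have e1 : (n : ℝ) + 1 - ν ≠ 0 := by linarith
    have e2 : (n : ℝ) + 2 - ν ≠ 0 := by linarith
    rw [orderDensity_succ (n + 1) ν (by omega), orderDensity_succ n ν hν, hc]
    push_cast
    have e3 : (n : ℝ) + 1 + 1 - ν ≠ 0 := by linarith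
    field_simp
    ring
  constructor
  · rw [integrable_orderLaw_iff]
    refine Integrable.congr ?_ (ae_restrict_of_ae (key.mono fun u hu => hu.symm))
    exact ((integrable_orderLaw_iff n ν f).1
      (integrable_orderLaw_of_continuous n ν hf)).const_mul c
  · rw [integral_orderLaw, integral_orderLaw, ← intervalIntegral.integral_const_mul]
    exact intervalIntegral.integral_congr_ae (key.mono fun u hu _ => hu)

theorem integral_pow_orderLaw (n ν : ℕ) (hν : ν ≤ n) (j : ℕ) :
    ∫ u, u ^ j ∂(orderLaw n ν) = ∏ i ∈ Finset.range j, ((ν : ℝ) + 1 + i) / (n + 2 + i) := by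
  rw [integral_orderLaw, integral_pow_mul_orderDensity n ν hν]

theorem pow_four_add_le (a b : ℝ) : (a + b) ^ 4 ≤ 8 * a ^ 4 + 8 * b ^ 4 := by
  have h1 : (a + b) ^ 2 ≤ 2 * (a ^ 2 + b ^ 2) := by nlinarith [sq_nonneg (a - b)]
  have h2 : ((a + b) ^ 2) ^ 2 ≤ (2 * (a ^ 2 + b ^ 2)) ^ 2 := pow_le_pow_left₀ (sq_nonneg _) h1 2
  nlinarith [sq_nonneg (a ^ 2 - b ^ 2)]

section CentralMoments

variable (n ν : ℕ)

/-- The integral of a quartic polynomial against the Beta law with mean `p`. -/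
theorem integral_quartic_orderLaw (hν : ν ≤ n) {N p : ℝ} (hN : N = n + 2)
    (hp : p = ((ν : ℝ) + 1) / N) (c₀ c₁ c₂ c₃ c₄ : ℝ) :
    ∫ u, (c₀ + c₁ * u + c₂ * u ^ 2 + c₃ * u ^ 3 + c₄ * u ^ 4) ∂(orderLaw n ν) =
      c₀ + c₁ * p + c₂ * (p * ((p * N + 1) / (N + 1))) +
        c₃ * (p * ((p * N + 1) / (N + 1)) * ((p * N + 2) / (N + 2))) +
        c₄ * (p * ((p * N + 1) / (N + 1)) * ((p * N + 2) / (N + 2)) *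
          ((p * N + 3) / (N + 3))) := by
  have := isProbabilityMeasure_orderLaw n ν hν
  have hN0 : (0 : ℝ) < N := by rw [hN]; positivity
  have hν' : (ν : ℝ) + 1 = p * N := by rw [hp]; field_simp
  have hi : ∀ j : ℕ, ∀ c : ℝ, Integrable (fun u => c * u ^ j) (orderLaw n ν) := fun j c =>
    integrable_orderLaw_of_continuous n ν (by fun_prop)
  have h : (fun u : ℝ => c₀ + c₁ * u + c₂ * u ^ 2 + c₃ * u ^ 3 + c₄ * u ^ 4) =
      (fun u => c₀ * u ^ 0) + (fun u => c₁ * u ^ 1) + (fun u => c₂ * u ^ 2) +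
        (fun u => c₃ * u ^ 3) + fun u => c₄ * u ^ 4 := by
    funext u
    simp
  rw [h, integral_add' ((((hi 0 c₀).add (hi 1 c₁)).add (hi 2 c₂)).add (hi 3 c₃)) (hi 4 c₄),
    integral_add' (((hi 0 c₀).add (hi 1 c₁)).add (hi 2 c₂)) (hi 3 c₃),
    integral_add' ((hi 0 c₀).add (hi 1 c₁)) (hi 2 c₂), integral_add' (hi 0 c₀) (hi 1 c₁)]
  simp only [integral_const_mul, integral_pow_orderLaw n ν hν, Finset.prod_range_succ,
    Finset.prod_range_zero, hν', ← hN]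
  push_cast
  have h0 : (p * N + 0) / (N + 0) = p := by rw [add_zero, add_zero]; field_simp
  rw [h0]
  ring

theorem integral_sub_orderLaw (hν : ν ≤ n) {N p : ℝ} (hN : N = n + 2)
    (hp : p = ((ν : ℝ) + 1) / N) (q : ℝ) : ∫ u, (u - q) ∂(orderLaw n ν) = p - q := by
  have h := integral_quartic_orderLaw n ν hν hN hp (-q) 1 0 0 0
  refine (integral_congr_ae (ae_of_all _ fun u => ?_)).trans (h.trans ?_) <;> ring

theorem integral_sub_sq_orderLaw (hν : ν ≤ n) {N p : ℝ} (hN : N = n + 2)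
    (hp : p = ((ν : ℝ) + 1) / N) (q : ℝ) :
    ∫ u, (u - q) ^ 2 ∂(orderLaw n ν) = p * (1 - p) / (N + 1) + (p - q) ^ 2 := by
  have hN0 : (0 : ℝ) < N := by rw [hN]; positivity
  have h := integral_quartic_orderLaw n ν hν hN hp (q ^ 2) (-2 * q) 1 0 0
  refine (integral_congr_ae (ae_of_all _ fun u => ?_)).trans (h.trans ?_)
  · ring
  · field_simp
    ring

theorem integral_sub_cube_orderLaw (hν : ν ≤ n) {N p : ℝ} (hN : N = n + 2)
    (hp : p = ((ν : ℝ) + 1) / N) (q : ℝ) :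
    ∫ u, (u - q) ^ 3 ∂(orderLaw n ν) = 2 * p * (1 - p) * (1 - 2 * p) / ((N + 1) * (N + 2)) +
      3 * (p - q) * (p * (1 - p) / (N + 1)) + (p - q) ^ 3 := by
  have hN0 : (0 : ℝ) < N := by rw [hN]; positivity
  have h := integral_quartic_orderLaw n ν hν hN hp (-q ^ 3) (3 * q ^ 2) (-3 * q) 1 0
  refine (integral_congr_ae (ae_of_all _ fun u => ?_)).trans (h.trans ?_)
  · ring
  · field_simp
    ring

theorem integral_sub_pow_four_orderLaw (hν : ν ≤ n) {N p : ℝ} (hN : N = n + 2)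
    (hp : p = ((ν : ℝ) + 1) / N) :
    ∫ u, (u - p) ^ 4 ∂(orderLaw n ν) =
      3 * p * (1 - p) * (2 + p * (1 - p) * (N - 6)) / ((N + 1) * (N + 2) * (N + 3)) := by
  have hN0 : (0 : ℝ) < N := by rw [hN]; positivity
  have h := integral_quartic_orderLaw n ν hν hN hp (p ^ 4) (-4 * p ^ 3) (6 * p ^ 2) (-4 * p) 1
  refine (integral_congr_ae (ae_of_all _ fun u => ?_)).trans (h.trans ?_)
  · ring
  · field_simp
    ring

theorem integral_sub_pow_four_orderLaw_le (hν : ν ≤ n) {N q : ℝ} (hN : N = n + 2)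
    (hq : |((ν : ℝ) + 1) / N - q| ≤ 2 / N) :
    ∫ u, (u - q) ^ 4 ∂(orderLaw n ν) ≤ 144 / N ^ 2 := by
  set p : ℝ := ((ν : ℝ) + 1) / N with hp
  have := isProbabilityMeasure_orderLaw n ν hν
  have hN0 : (2 : ℝ) ≤ N := by rw [hN]; linarith [Nat.cast_nonneg (α := ℝ) n]
  have hνn : (ν : ℝ) ≤ n := by exact_mod_cast hν
  have hp0 : 0 ≤ p := by positivity
  have hp1 : p ≤ 1 := by rw [hp, div_le_one (by linarith)]; linarith
  have hpp0 : 0 ≤ p * (1 - p) := mul_nonneg hp0 (by linarith)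
  have hpp : p * (1 - p) ≤ 1 / 4 := by nlinarith [sq_nonneg (p - 1 / 2)]
  have h1 : ∫ u, (u - q) ^ 4 ∂(orderLaw n ν) ≤
      ∫ u, (8 * (u - p) ^ 4 + 8 * (p - q) ^ 4) ∂(orderLaw n ν) := by
    refine integral_mono (integrable_orderLaw_of_continuous n ν (by fun_prop))
      (integrable_orderLaw_of_continuous n ν (by fun_prop)) fun u => ?_
    have e : u - q = (u - p) + (p - q) := by ring
    simp only [e]
    generalize u - p = a
    generalize p - q = b
    exact pow_four_add_le a b
  rw [integral_add (integrable_orderLaw_of_continuous n ν (by fun_prop)) (integrable_const _),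
    integral_const_mul, integral_sub_pow_four_orderLaw n ν hν hN hp] at h1
  simp only [integral_const, probReal_univ, one_smul] at h1
  have h2 : 3 * p * (1 - p) * (2 + p * (1 - p) * (N - 6)) / ((N + 1) * (N + 2) * (N + 3)) ≤
      2 / N ^ 2 := by
    rw [div_le_div_iff₀ (by positivity) (by positivity)]
    have h3 : 3 * p * (1 - p) * (2 + p * (1 - p) * (N - 6)) ≤ 3 / 4 * (2 + N / 4) := by
      have : p * (1 - p) * (N - 6) ≤ N / 4 := by nlinarith
      have h5 : 0 ≤ 2 + N / 4 := by linarith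
      nlinarith
    nlinarith [mul_le_mul_of_nonneg_right h3 (sq_nonneg N), sq_nonneg N]
  have h4 : (p - q) ^ 4 ≤ 16 / N ^ 2 := by
    have h5 : (p - q) ^ 4 ≤ (2 / N) ^ 4 := by
      rw [← Even.pow_abs (by decide : Even 4) (p - q)]
      gcongr
    refine h5.trans ?_
    rw [div_pow, div_le_div_iff₀ (by positivity) (by positivity)]
    have h6 : 1 ≤ N ^ 2 := by nlinarith
    nlinarith
  calc _ ≤ _ := h1
    _ ≤ 8 * (2 / N ^ 2) + 8 * (16 / N ^ 2) := by gcongr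
    _ = 144 / N ^ 2 := by ring

end CentralMoments

/-! ### The empirical quantile as an order statistic -/

theorem le_empiricalCDF_iff_ceil_le {q : ℝ} {k : ℕ} (hk : 0 < k) (z : ℕ → ℝ) (t : ℝ) :
    q ≤ empiricalCDF k z t ↔ ⌈q * k⌉₊ ≤ ((Finset.range k).filter fun j => z j ≤ t).card := by
  rw [empiricalCDF, le_div_iff₀ (by exact_mod_cast hk), Nat.ceil_le]

/-- The event that at least `m` of `k` conditions hold, as a finite union of finite intersections;
this makes it closed or measurable when the single conditions are. -/
theorem setOf_le_card_filter_eq {ι : Type*} (k m : ℕ) (p : ℕ → ι → Prop)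
    [∀ j i, Decidable (p j i)] :
    {i | m ≤ ((Finset.range k).filter fun j => p j i).card} =
      ⋃ s ∈ (Finset.range k).powersetCard m, ⋂ j ∈ s, {i | p j i} := by
  ext i
  simp only [Set.mem_ofPred_eq, Set.mem_iUnion, Finset.mem_powersetCard, Set.mem_iInter,
    exists_prop]
  constructor
  · intro h
    obtain ⟨s, hs, hc⟩ := Finset.exists_subset_card_eq h
    exact ⟨s, ⟨hs.trans (Finset.filter_subset _ _), hc⟩,
      fun j hj => (Finset.mem_filter.1 (hs hj)).2⟩
  · rintro ⟨s, ⟨hs, rfl⟩, h⟩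
    exact Finset.card_le_card fun j hj => Finset.mem_filter.2 ⟨hs hj, h j hj⟩

/-- The empirical `q`-quantile is at most `t` if and only if at least `⌈q k⌉` of the `k` sample
values are. -/
theorem quantile_empiricalCDF_le_iff {q : ℝ} (hq0 : 0 < q) (hq1 : q < 1) {k : ℕ} (hk : 0 < k)
    (z : ℕ → ℝ) (t : ℝ) : quantile (empiricalCDF k z) q ≤ t ↔
      ⌈q * k⌉₊ ≤ ((Finset.range k).filter fun j => z j ≤ t).card := by
  set S := {t : ℝ | q ≤ empiricalCDF k z t} with hS
  have hkR : (0 : ℝ) < k := by exact_mod_cast hk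
  have hm : 0 < ⌈q * k⌉₊ := Nat.ceil_pos.2 (by positivity)
  have hS' : S = ⋃ s ∈ (Finset.range k).powersetCard ⌈q * k⌉₊, ⋂ j ∈ s, {t | z j ≤ t} := by
    rw [← setOf_le_card_filter_eq k ⌈q * k⌉₊ fun j t => z j ≤ t, hS]
    ext t
    exact le_empiricalCDF_iff_ceil_le hk z t
  have hclosed : IsClosed S := by
    rw [hS']
    refine Set.Finite.isClosed_biUnion (Finset.finite_toSet _) fun s _ => ?_
    exact isClosed_biInter fun j _ => isClosed_Ici
  have hne : S.Nonempty := by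
    obtain ⟨B, hB⟩ := ((Finset.range k).image z).bddAbove
    refine ⟨B, (le_empiricalCDF_iff_ceil_le hk z B).2 ?_⟩
    rw [Finset.filter_true_of_mem fun j hj => hB (Finset.mem_coe.2
      (Finset.mem_image_of_mem z hj)), Finset.card_range, Nat.ceil_le]
    nlinarith
  have hbdd : BddBelow S := by
    obtain ⟨b, hb⟩ := ((Finset.range k).image z).bddBelow
    refine ⟨b, fun t ht => ?_⟩
    obtain ⟨j, hj⟩ := Finset.card_pos.1 (hm.trans_le ((le_empiricalCDF_iff_ceil_le hk z t).1 ht))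
    rw [Finset.mem_filter] at hj
    exact (hb (Finset.mem_coe.2 (Finset.mem_image_of_mem z hj.1))).trans hj.2
  rw [← le_empiricalCDF_iff_ceil_le hk z t]
  constructor
  · intro h
    have h0 : quantile (empiricalCDF k z) q ∈ S := hclosed.csInf_mem hne hbdd
    refine le_trans h0 ?_
    unfold empiricalCDF
    refine div_le_div_of_nonneg_right (Nat.cast_le.2 (Finset.card_le_card fun j hj => ?_)) hkR.le
    rw [Finset.mem_filter] at hj ⊢
    exact ⟨hj.1, hj.2.trans h⟩
  · exact fun h => csInf_le hbdd h

theorem quantile_empiricalCDF_nonneg {q : ℝ} (hq0 : 0 < q) {k : ℕ} (hk : 0 < k) {z : ℕ → ℝ}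
    (hz : ∀ j, 0 ≤ z j) : 0 ≤ quantile (empiricalCDF k z) q := by
  have hkR : (0 : ℝ) < k := by exact_mod_cast hk
  refine Real.sInf_nonneg fun t ht => ?_
  have h := (le_empiricalCDF_iff_ceil_le hk z t).1 ht
  obtain ⟨j, hj⟩ := Finset.card_pos.1 ((Nat.ceil_pos.2 (by positivity : 0 < q * k)).trans_le h)
  exact (hz j).trans (Finset.mem_filter.1 hj).2

theorem measurable_quantile_empiricalCDF {q : ℝ} (hq0 : 0 < q) (hq1 : q < 1) {k : ℕ} (hk : 0 < k) :
    Measurable fun z : ℕ → ℝ => quantile (empiricalCDF k z) q := by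
  refine measurable_of_Iic fun t => ?_
  have : (fun z : ℕ → ℝ => quantile (empiricalCDF k z) q) ⁻¹' Set.Iic t =
      {z : ℕ → ℝ | ⌈q * k⌉₊ ≤ ((Finset.range k).filter fun j => z j ≤ t).card} := by
    ext z
    exact quantile_empiricalCDF_le_iff hq0 hq1 hk z t
  rw [this, setOf_le_card_filter_eq k ⌈q * k⌉₊ fun j (z : ℕ → ℝ) => z j ≤ t]
  refine Finset.measurableSet_biUnion _ fun s _ => Finset.measurableSet_biInter _ fun j _ => ?_
  exact measurableSet_le (measurable_pi_apply j) measurable_const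

section Independent

variable {Ω : Type*} [MeasurableSpace Ω] {P : Measure Ω} [IsProbabilityMeasure P]

/-- The number of `j < k` with `z j ≤ t` is a binomial variable. -/
theorem measureReal_le_card_filter_eq_binomialTail {z : ℕ → Ω → ℝ} (hz : ∀ j, AEMeasurable (z j) P)
    (hind : iIndepFun z P) {t p : ℝ} (hp : ∀ j, P.real {ω | z j ω ≤ t} = p) (k m : ℕ) :
    P.real {ω | m ≤ ((Finset.range k).filter fun j => z j ω ≤ t).card} = binomialTail k m p := by
  classical
  let A : Ω → Finset ℕ := fun ω => (Finset.range k).filter fun j => z j ω ≤ t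
  let B : Finset ℕ → ℕ → Set ℝ := fun s j => if j ∈ s then Set.Iic t else Set.Ioi t
  have hB : ∀ s j, MeasurableSet (B s j) := by
    intro s j
    by_cases h : j ∈ s <;> simp [B, h, measurableSet_Iic, measurableSet_Ioi]
  have hA : ∀ s ⊆ Finset.range k, {ω | A ω = s} = ⋂ j ∈ Finset.range k, z j ⁻¹' B s j := by
    intro s hs
    ext ω
    simp only [Set.mem_ofPred_eq, Set.mem_iInter, Set.mem_preimage, A]
    constructor
    · rintro rfl j hj
      by_cases h : z j ω ≤ t
      · simp [B, h, Finset.mem_range.1 hj]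
      · simp only [B, Finset.mem_filter, h, and_false, if_false, Set.mem_Ioi]
        exact not_le.1 h
    · intro h
      ext j
      by_cases hj : j ∈ Finset.range k
      · have := h j hj
        by_cases hjs : j ∈ s
        · simp only [B, hjs, if_true, Set.mem_Iic] at this
          simp [hjs, this, Finset.mem_range.1 hj]
        · simp only [B, hjs, if_false, Set.mem_Ioi] at this
          simp [hjs, this]
      · simp only [Finset.mem_filter, hj, false_and, false_iff]
        exact fun h => hj (hs h)
  have hnull : ∀ s ⊆ Finset.range k, NullMeasurableSet {ω | A ω = s} P := by
    intro s hs
    rw [hA s hs]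
    exact Finset.nullMeasurableSet_biInter _ fun j _ => (hz j).nullMeasurable (hB s j)
  have hP : ∀ s ⊆ Finset.range k, P.real {ω | A ω = s} = p ^ s.card * (1 - p) ^ (k - s.card) := by
    intro s hs
    rw [hA s hs, measureReal_def, hind.measure_inter_preimage_eq_mul _ fun j _ => hB s j,
      ENNReal.toReal_prod]
    have h1 : ∀ j, (P (z j ⁻¹' B s j)).toReal = if j ∈ s then p else 1 - p := by
      intro j
      by_cases h : j ∈ s
      · simp only [B, h, if_true]
        exact hp j
      · simp only [B, h, if_false]
        rw [← hp j, ← measureReal_def, ← Set.compl_Iic, Set.preimage_compl,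
          probReal_compl_eq_one_sub₀ ((hz j).nullMeasurable measurableSet_Iic)]
        rfl
    simp only [h1]
    rw [Finset.prod_ite, Finset.prod_const, Finset.prod_const, Finset.filter_mem_eq_inter,
      Finset.inter_eq_right.2 hs, Finset.filter_notMem_eq_sdiff, Finset.card_sdiff_of_subset hs,
      Finset.card_range]
  have hun : {ω | m ≤ ((Finset.range k).filter fun j => z j ω ≤ t).card} =
      ⋃ s ∈ (Finset.range k).powerset.filter (fun s => m ≤ s.card), {ω | A ω = s} := by
    ext ω
    simp only [Set.mem_ofPred_eq, Set.mem_iUnion, Finset.mem_filter, Finset.mem_powerset,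
      exists_prop]
    constructor
    · exact fun h => ⟨A ω, ⟨Finset.filter_subset _ _, h⟩, rfl⟩
    · rintro ⟨s, ⟨-, h⟩, rfl⟩
      exact h
  rw [hun, measureReal_def, measure_biUnion_finset₀]
  · rw [ENNReal.toReal_sum fun s _ => measure_ne_top _ _]
    have h1 : ∀ s ∈ (Finset.range k).powerset.filter (fun s => m ≤ s.card),
        (P {ω | A ω = s}).toReal = p ^ s.card * (1 - p) ^ (k - s.card) := fun s hs =>
      hP s (Finset.mem_powerset.1 (Finset.mem_filter.1 hs).1)
    rw [Finset.sum_congr rfl h1, Finset.sum_filter, Finset.sum_powerset_apply_card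
      (f := fun i => if m ≤ i then p ^ i * (1 - p) ^ (k - i) else 0), Finset.card_range,
      binomialTail]
    have h2 : Finset.Ico m (k + 1) = (Finset.range (k + 1)).filter fun i => m ≤ i := by
      ext i
      simp only [Finset.mem_Ico, Finset.mem_filter, Finset.mem_range]
      tauto
    rw [h2, Finset.sum_filter]
    refine Finset.sum_congr rfl fun i _ => ?_
    split_ifs
    · rw [nsmul_eq_mul, mul_assoc]
    · simp
  · intro s _ s' _ hne
    refine Disjoint.aedisjoint (Set.disjoint_left.2 fun ω h h' => hne ?_)
    exact (show A ω = s from h).symm.trans h'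
  · exact fun s hs => hnull s (Finset.mem_powerset.1 (Finset.mem_filter.1 hs).1)

/-- Probability integral transform of an order statistic: the `(ν + 1)`-st smallest of `n + 1`
values with the continuous distribution function `G` on `[0, ∞)` is carried by `G` to the
corresponding order statistic of a uniform sample. -/
theorem map_eq_orderLaw {Q : Ω → ℝ} (hQm : AEMeasurable Q P) (hQ0 : ∀ ω, 0 ≤ Q ω) {G : ℝ → ℝ}
    (hGm : Measurable G) (hGmono : StrictMonoOn G (Set.Ici 0)) (hGc : ContinuousOn G (Set.Ici 0))
    (hG0 : G 0 = 0) (hG1 : Tendsto G atTop (𝓝 1)) {n ν : ℕ} (hν : ν ≤ n)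
    (hQ : ∀ t, 0 ≤ t → P.real {ω | Q ω ≤ t} = binomialTail (n + 1) (ν + 1) (G t)) :
    P.map (fun ω => G (Q ω)) = orderLaw n ν := by
  have hprob := isProbabilityMeasure_orderLaw n ν hν
  have hm : AEMeasurable (fun ω => G (Q ω)) P := hGm.comp_aemeasurable hQm
  have := Measure.isProbabilityMeasure_map hm
  have hlt : ∀ t, 0 ≤ t → G t < 1 := by
    intro t ht
    have h1 : G t < G (t + 1) := hGmono ht (by simp; linarith) (by linarith)
    refine h1.trans_le (ge_of_tendsto hG1 ?_)
    filter_upwards [eventually_ge_atTop (t + 1)] with s hs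
    exact hGmono.monotoneOn (by simp; linarith) (by simp; linarith) hs
  have hnn : ∀ t, 0 ≤ t → 0 ≤ G t := fun t ht => by
    rw [← hG0]
    exact hGmono.monotoneOn (by simp) ht ht
  refine Measure.ext_of_Iic _ _ fun u => ?_
  rw [Measure.map_apply_of_aemeasurable hm measurableSet_Iic]
  rcases lt_or_ge u 0 with hu | hu
  · have h1 : (fun ω => G (Q ω)) ⁻¹' Set.Iic u = ∅ := by
      ext ω
      simpa using hu.trans_le (hnn _ (hQ0 ω))
    have h2 : orderLaw n ν (Set.Iic u) = 0 :=
      measure_mono_null (t := (Set.Ioc 0 1)ᶜ)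
        (fun x hx h => by linarith [h.1, Set.mem_Iic.1 hx]) (orderLaw_compl n ν)
    rw [h1, h2, measure_empty]
  rcases lt_or_ge u 1 with hu1 | hu1
  · obtain ⟨b, hb, hb0⟩ := ((hG1.eventually_const_lt hu1).and (eventually_ge_atTop 0)).exists
    obtain ⟨t, ht, rfl⟩ := intermediate_value_Icc hb0 (hGc.mono Set.Icc_subset_Ici_self)
      (show u ∈ Set.Icc (G 0) (G b) from ⟨by rwa [hG0], hb.le⟩)
    have h1 : (fun ω => G (Q ω)) ⁻¹' Set.Iic (G t) = {ω | Q ω ≤ t} := by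
      ext ω
      exact hGmono.le_iff_le (hQ0 ω) ht.1
    rw [orderLaw_Iic n ν hν hu hu1.le, h1, ← hQ t ht.1, ofReal_measureReal]
  · have h1 : (fun ω => G (Q ω)) ⁻¹' Set.Iic u = Set.univ := by
      ext ω
      simpa using ((hlt _ (hQ0 ω)).trans_le hu1).le
    have h2 : orderLaw n ν (Set.Iic u) = 1 := by
      refine le_antisymm prob_le_one ?_
      have h3 := orderLaw_Iic n ν hν zero_le_one le_rfl
      rw [binomialTail_one _ _ (by omega), ENNReal.ofReal_one] at h3
      rw [← h3]
      exact measure_mono (Set.Iic_subset_Iic.2 hu1)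
    rw [h1, h2, measure_univ]

end Independent

/-! ### Second-order expansions -/

theorem exists_isBigO_taylor_two {f : ℝ → ℝ} {s : Set ℝ} (hs : IsOpen s) (hsc : Convex ℝ s)
    {x₀ : ℝ} (hx₀ : x₀ ∈ s) (hf : ContDiffOn ℝ 3 f s) :
    ∃ b, (fun x => f x - f x₀ - deriv f x₀ * (x - x₀) - b * (x - x₀) ^ 2) =O[𝓝 x₀]
      fun x => (x - x₀) ^ 3 := by
  have h := (taylor_isLittleO hsc hx₀ (n := 3) (by exact_mod_cast hf)).isBigO
  rw [hs.nhdsWithin_eq hx₀] at h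
  refine ⟨2⁻¹ * iteratedDerivWithin 2 f s x₀, ?_⟩
  have h3 : (fun x => 6⁻¹ * iteratedDerivWithin 3 f s x₀ * (x - x₀) ^ 3) =O[𝓝 x₀]
      fun x => (x - x₀) ^ 3 := isBigO_const_mul_self _ _ _
  refine (h.add h3).congr_left fun x => ?_
  simp only [taylorWithinEval_succ, taylor_within_zero_eval, zero_add, iteratedDerivWithin_one,
    derivWithin_of_isOpen hs hx₀, smul_eq_mul]
  norm_num [Nat.factorial]
  ring

/-- If `f` and `g` have second-order expansions at `W` and `g' W ≠ 0`, then `f` has a second-order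
expansion in powers of `g - g W`. This replaces an expansion of `f ∘ g⁻¹`. -/
theorem exists_isBigO_expansion_comp {f g : ℝ → ℝ} {s : Set ℝ} (hs : IsOpen s)
    (hsc : Convex ℝ s) {W : ℝ} (hW : W ∈ s) (hf : ContDiffOn ℝ 3 f s) (hg : ContDiffOn ℝ 3 g s)
    (hg' : deriv g W ≠ 0) :
    ∃ c, (fun y => f y - f W - deriv f W / deriv g W * (g y - g W) - c * (g y - g W) ^ 2)
      =O[𝓝 W] fun y => (g y - g W) ^ 3 := by
  obtain ⟨bf, hbf⟩ := exists_isBigO_taylor_two hs hsc hW hf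
  obtain ⟨bg, hbg⟩ := exists_isBigO_taylor_two hs hsc hW hg
  have hgd : HasDerivAt g (deriv g W) W :=
    ((hg.differentiableOn (by norm_num)).differentiableAt (hs.mem_nhds hW)).hasDerivAt
  have hrev : (fun y => y - W) =O[𝓝 W] fun y => g y - g W :=
    (hgd.isTheta_sub hg').isBigO_symm.comp_tendsto
      (tendsto_id.prodMk (tendsto_pure.2 (Eventually.of_forall fun _ => rfl)))
  set g₁ := deriv g W
  set c₁ := deriv f W / g₁ with hc₁
  set c₂ := (bf - c₁ * bg) / g₁ ^ 2 with hc₂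
  refine ⟨c₂, IsBigO.trans ?_ (hrev.pow 3)⟩
  have hsmall : (fun y : ℝ => y - W) =O[𝓝 W] fun _ => (1 : ℝ) := by
    have : ContinuousAt (fun y : ℝ => y - W) W := by fun_prop
    exact this.isBigO_one ℝ
  have h32 : (fun y : ℝ => (y - W) ^ 3) =O[𝓝 W] fun y => (y - W) ^ 2 := by
    refine ((isBigO_refl (fun y : ℝ => (y - W) ^ 2) (𝓝 W)).mul hsmall).congr
      (fun y => by ring) (fun y => by ring)
  -- the remainder of `g` after its linear part is of second order
  have hr : (fun y => g y - g W - g₁ * (y - W)) =O[𝓝 W] fun y => (y - W) ^ 2 := by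
    have h2 : (fun y : ℝ => bg * (y - W) ^ 2) =O[𝓝 W] fun y => (y - W) ^ 2 :=
      isBigO_const_mul_self _ _ _
    exact ((hbg.trans h32).add h2).congr_left fun y => by ring
  have hlin : (fun y => (g y - g W) + g₁ * (y - W)) =O[𝓝 W] fun y => y - W := by
    have h1 : (fun y => g y - g W) =O[𝓝 W] fun y => y - W := hgd.isBigO_sub
    exact h1.add (isBigO_const_mul_self _ _ _)
  have hsq : (fun y => (g y - g W) ^ 2 - g₁ ^ 2 * (y - W) ^ 2) =O[𝓝 W] fun y => (y - W) ^ 3 :=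
    (hr.mul hlin).congr (fun y => by ring) (fun y => by ring)
  refine ((hbf.sub (hbg.const_mul_left c₁)).sub (hsq.const_mul_left c₂)).congr_left fun y => ?_
  have e1 : c₁ * g₁ = deriv f W := by rw [hc₁]; field_simp
  have e2 : c₂ * g₁ ^ 2 = bf - c₁ * bg := by rw [hc₂]; field_simp
  linear_combination (y - W) * e1 + (y - W) ^ 2 * e2

/-- Global form of the expansion: the local bound near `W` and the growth `h = O(1 / (1 - G))`
combine into one bound on `[0, ∞)`. -/
theorem exists_global_expansion {h G : ℝ → ℝ} {W K : ℝ} (hW : 0 < W)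
    (hh : ContDiffOn ℝ 3 h (Set.Ioi 0)) (hG : ContDiffOn ℝ 3 G (Set.Ioi 0))
    (hG' : deriv G W ≠ 0) (hmono : StrictMonoOn G (Set.Ici 0)) (hG0 : ∀ y, 0 ≤ y → 0 ≤ G y)
    (hG1 : ∀ y, 0 ≤ y → G y < 1) (hK : ∀ y, 0 ≤ y → |h y| ≤ K / (1 - G y)) :
    ∃ c C, 0 ≤ C ∧ ∀ y, 0 ≤ y →
      |h y - h W - deriv h W / deriv G W * (G y - G W) - c * (G y - G W) ^ 2| ≤
        C * |G y - G W| ^ 3 * (1 / (1 - G y)) := by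
  obtain ⟨c, hc⟩ := exists_isBigO_expansion_comp isOpen_Ioi (convex_Ioi 0) hW hh hG hG'
  obtain ⟨C₀, hC₀, hb⟩ := hc.exists_pos
  rw [isBigOWith_iff, Metric.eventually_nhds_iff] at hb
  obtain ⟨ε, hε, hb⟩ := hb
  set δ := min (ε / 2) (W / 2) with hδ
  have hδ0 : 0 < δ := by positivity
  have hδε : δ < ε := (min_le_left _ _).trans_lt (by linarith)
  have hδW : δ < W := (min_le_right _ _).trans_lt (by linarith)
  set η := min (G (W + δ) - G W) (G W - G (W - δ)) with hη
  have hη0 : 0 < η := lt_min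
    (sub_pos.2 (hmono hW.le (by simp; linarith) (by linarith)))
    (sub_pos.2 (hmono (by simp; linarith) hW.le (by linarith)))
  set c₁ := deriv h W / deriv G W
  have hK0 : 0 ≤ K := by
    have h1 := (abs_nonneg _).trans (hK W hW.le)
    by_contra! hneg
    exact absurd h1 (not_le.2 (div_neg_of_neg_of_pos hneg (by linarith [hG1 W hW.le])))
  set C₁ := (K + |h W| + |c₁| + |c|) / η ^ 3 with hC₁
  have hC₁0 : 0 ≤ C₁ := by positivity
  refine ⟨c, C₀ + C₁, by positivity, fun y hy => ?_⟩
  have h1G : 0 < 1 - G y := by linarith [hG1 y hy]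
  have hone : 1 ≤ 1 / (1 - G y) := by
    rw [le_div_iff₀ h1G]; linarith [hG0 y hy]
  set r := 1 / (1 - G y) with hr
  set V := |G y - G W| with hV
  have hV0 : 0 ≤ V := abs_nonneg _
  by_cases hyW : dist y W < δ
  · have h1 := hb (hyW.trans hδε)
    rw [Real.norm_eq_abs, Real.norm_eq_abs, abs_pow] at h1
    calc _ ≤ C₀ * V ^ 3 := h1
      _ ≤ (C₀ + C₁) * V ^ 3 := by gcongr; linarith
      _ = (C₀ + C₁) * V ^ 3 * 1 := by ring
      _ ≤ _ := by gcongr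
  · have hVη : η ≤ V := by
      rw [Real.dist_eq, not_lt, le_abs] at hyW
      rcases hyW with h2 | h2
      · have : G (W + δ) ≤ G y := hmono.monotoneOn (by simp; linarith) hy (by linarith)
        exact (min_le_left _ _).trans ((by linarith : _ ≤ G y - G W).trans (le_abs_self _))
      · have : G y ≤ G (W - δ) := hmono.monotoneOn hy (by simp; linarith) (by linarith)
        exact (min_le_right _ _).trans ((by linarith : _ ≤ -(G y - G W)).trans (neg_le_abs _))
    have hV1 : V ≤ 1 := abs_le.2 ⟨by linarith [hG0 y hy, hG1 W hW.le],
      by linarith [hG1 y hy, hG0 W hW.le]⟩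
    have hKr : |h y| ≤ K * r := by rw [hr, mul_one_div]; exact hK y hy
    calc |h y - h W - c₁ * (G y - G W) - c * (G y - G W) ^ 2|
        ≤ |h y| + |h W| + |c₁| * V + |c| * V ^ 2 := by
          refine (abs_sub _ _).trans (add_le_add ((abs_sub _ _).trans
            (add_le_add (abs_sub _ _) ?_)) ?_)
          · rw [abs_mul]
          · rw [abs_mul, abs_pow]
      _ ≤ K * r + |h W| * r + |c₁| * r + |c| * r := by
          have hVr : V ≤ r := hV1.trans hone
          have hV2r : V ^ 2 ≤ r := (pow_le_one₀ hV0 hV1).trans hone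
          gcongr
          exact le_mul_of_one_le_right (abs_nonneg _) hone
      _ = C₁ * η ^ 3 * r := by rw [hC₁]; field_simp
      _ ≤ (C₀ + C₁) * V ^ 3 * r := by gcongr; linarith

/-! ### Variance of a second-order expansion -/

section Variance

variable {Ω : Type*} [MeasurableSpace Ω] {P : Measure Ω} [IsProbabilityMeasure P]

/-- The delta method for the variance, with an explicit error. Here `r` is a weight that controls
the growth of `T`; the error involves only `E[V ^ 4 r ^ 2]`, `E[r ^ 2]` and `cov(V, V ^ 2)`. -/
theorem variance_expansion {V T r : Ω → ℝ} {c₀ c₁ c₂ C : ℝ} (hV : AEMeasurable V P)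
    (hT : AEMeasurable T P) (hV1 : ∀ ω, |V ω| ≤ 1) (hr1 : ∀ ω, 1 ≤ r ω) (hC : 0 ≤ C)
    (hR : ∀ ω, |T ω - c₀ - c₁ * V ω - c₂ * V ω ^ 2| ≤ C * |V ω| ^ 3 * r ω)
    (hi : Integrable (fun ω => V ω ^ 4 * r ω ^ 2) P) (hir : Integrable (fun ω => r ω ^ 2) P) :
    MemLp T 2 P ∧
    |Var[T; P] - c₁ ^ 2 * Var[V; P]| ≤ 2 * |c₁| * |c₂| * |cov[V, fun ω => V ω ^ 2; P]| +
      2 * |c₁| * C * (1 + (∫ ω, r ω ^ 2 ∂P + 3) / 4) * (∫ ω, V ω ^ 4 * r ω ^ 2 ∂P) +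
      2 * (c₂ ^ 2 + C ^ 2) * ∫ ω, V ω ^ 4 * r ω ^ 2 ∂P := by
  set e := ∫ ω, V ω ^ 4 * r ω ^ 2 ∂P with he
  set R : Ω → ℝ := fun ω => T ω - c₀ - c₁ * V ω - c₂ * V ω ^ 2 with hRdef
  have hRm : AEMeasurable R P := by fun_prop
  have hbV : ∀ {f : Ω → ℝ}, AEMeasurable f P → (∀ ω, |f ω| ≤ 1) → MemLp f 2 P :=
    fun hf hb => MemLp.of_bound hf.aestronglyMeasurable 1 (ae_of_all _ hb)
  have hV2m : AEMeasurable (fun ω => V ω ^ 2) P := by fun_prop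
  have hVL : MemLp V 2 P := hbV hV hV1
  have hV2L : MemLp (fun ω => V ω ^ 2) 2 P := hbV hV2m fun ω => by
    rw [abs_pow]; exact pow_le_one₀ (abs_nonneg _) (hV1 ω)
  have hr0 : ∀ ω, 0 ≤ r ω := fun ω => zero_le_one.trans (hr1 ω)
  have hrr : ∀ ω, r ω ≤ r ω ^ 2 := fun ω => by nlinarith [hr1 ω]
  -- pointwise bounds on the remainder
  have hRsq : ∀ ω, R ω ^ 2 ≤ C ^ 2 * (V ω ^ 4 * r ω ^ 2) := by
    intro ω
    have h1 : R ω ^ 2 ≤ (C * |V ω| ^ 3 * r ω) ^ 2 := by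
      rw [← sq_abs]
      exact pow_le_pow_left₀ (abs_nonneg _) (hR ω) 2
    have h2 : |V ω| ^ 6 ≤ |V ω| ^ 4 := pow_le_pow_of_le_one (abs_nonneg _) (hV1 ω) (by norm_num)
    have h3 : |V ω| ^ 4 = V ω ^ 4 := Even.pow_abs (by decide) _
    calc _ ≤ _ := h1
      _ = C ^ 2 * (|V ω| ^ 6 * r ω ^ 2) := by ring
      _ ≤ C ^ 2 * (|V ω| ^ 4 * r ω ^ 2) := by gcongr
      _ = _ := by rw [h3]
  have hRL : MemLp R 2 P := by
    rw [memLp_two_iff_integrable_sq hRm.aestronglyMeasurable]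
    refine (hi.const_mul (C ^ 2)).mono' (by fun_prop) (ae_of_all _ fun ω => ?_)
    rw [Real.norm_of_nonneg (sq_nonneg _)]
    exact hRsq ω
  have hQL : MemLp (fun ω => c₂ * V ω ^ 2 + R ω) 2 P := (hV2L.const_mul c₂).add hRL
  have hAL : MemLp (fun ω => c₁ * V ω) 2 P := hVL.const_mul c₁
  have hTeq : T = fun ω => c₀ + ((fun ω => c₁ * V ω) + fun ω => c₂ * V ω ^ 2 + R ω) ω := by
    funext ω
    simp only [hRdef, Pi.add_apply]
    ring
  have hTL : MemLp T 2 P := by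
    rw [hTeq]
    exact (memLp_const c₀).add (hAL.add hQL)
  refine ⟨hTL, ?_⟩
  have hvar : Var[T; P] = c₁ ^ 2 * Var[V; P] +
      2 * (c₁ * (c₂ * cov[V, fun ω => V ω ^ 2; P] + cov[V, R; P])) +
      Var[fun ω => c₂ * V ω ^ 2 + R ω; P] := by
    have h1 : cov[V, fun ω => c₂ * V ω ^ 2 + R ω; P] =
        c₂ * cov[V, fun ω => V ω ^ 2; P] + cov[V, R; P] := by
      rw [← covariance_const_mul_right]
      exact covariance_add_right hVL (hV2L.const_mul c₂) hRL
    rw [hTeq, variance_const_add (hAL.add hQL).aestronglyMeasurable, variance_add hAL hQL,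
      variance_const_mul, covariance_const_mul_left, h1]
  -- the variance of the nonlinear part
  have hvQ : Var[fun ω => c₂ * V ω ^ 2 + R ω; P] ≤ 2 * (c₂ ^ 2 + C ^ 2) * e := by
    refine (variance_le_expectation_sq hQL.aestronglyMeasurable).trans ?_
    rw [he, ← integral_const_mul]
    refine integral_mono_of_nonneg (ae_of_all _ fun ω => sq_nonneg _) (hi.const_mul _)
      (ae_of_all _ fun ω => ?_)
    simp only [Pi.pow_apply]
    have h1 := hRsq ω
    have h2 : V ω ^ 4 ≤ V ω ^ 4 * r ω ^ 2 :=
      le_mul_of_one_le_right (by positivity) (one_le_pow₀ (hr1 ω))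
    nlinarith [sq_nonneg (c₂ * V ω ^ 2 - R ω), mul_le_mul_of_nonneg_left h2 (sq_nonneg c₂)]
  have hV4i : Integrable (fun ω => V ω ^ 4) P :=
    Integrable.of_bound (by fun_prop) 1 (ae_of_all _ fun ω => by
      rw [norm_pow]; exact pow_le_one₀ (norm_nonneg _) (hV1 ω))
  have hV4e : ∫ ω, V ω ^ 4 ∂P ≤ e := integral_mono hV4i hi fun ω =>
    le_mul_of_one_le_right (by positivity) (one_le_pow₀ (hr1 ω))
  set l := ∫ ω, |V ω| ∂P with hl
  have hVi : Integrable (fun ω => |V ω|) P := (hVL.integrable one_le_two).abs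
  have hl0 : 0 ≤ l := integral_nonneg fun ω => abs_nonneg _
  have hamgm : ∀ a b : ℝ, 0 ≤ a → 0 ≤ b → 4 * (a * b ^ 3) ≤ a ^ 4 + 3 * b ^ 4 := by
    intro a b ha hb
    nlinarith [mul_nonneg (sq_nonneg (a - b)) (add_nonneg (sq_nonneg (a + b)) (sq_nonneg b)),
      mul_nonneg (sq_nonneg (a - b)) (sq_nonneg b), mul_nonneg (sq_nonneg (a - b)) (sq_nonneg a),
      mul_nonneg (sq_nonneg (a - b)) (mul_nonneg ha hb)]
  -- Jensen's inequality, from the tangent line of the fourth power at `l`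
  have hl4 : l ^ 4 ≤ e := by
    refine le_trans ?_ hV4e
    have h1 : ∫ ω, (4 * l ^ 3 * |V ω| - 3 * l ^ 4) ∂P ≤ ∫ ω, V ω ^ 4 ∂P := by
      refine integral_mono ((hVi.const_mul _).sub (integrable_const _)) hV4i fun ω => ?_
      have h2 := hamgm |V ω| l (abs_nonneg _) hl0
      rw [Even.pow_abs (n := 4) (by decide) (V ω)] at h2
      show 4 * l ^ 3 * |V ω| - 3 * l ^ 4 ≤ V ω ^ 4
      linarith
    rw [integral_sub (hVi.const_mul _) (integrable_const _), integral_const_mul] at h1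
    simp only [integral_const, probReal_univ, one_smul] at h1
    rw [← hl] at h1
    nlinarith
  have hRi : Integrable R P := hRL.integrable one_le_two
  have hVR : |∫ ω, V ω * R ω ∂P| ≤ C * e := by
    rw [he, ← integral_const_mul]
    rw [← Real.norm_eq_abs]
    refine norm_integral_le_of_norm_le (hi.const_mul C) (ae_of_all _ fun ω => ?_)
    rw [norm_mul, Real.norm_eq_abs, Real.norm_eq_abs]
    have h3 : |V ω| ^ 4 = V ω ^ 4 := Even.pow_abs (by decide) _
    calc |V ω| * |R ω| ≤ |V ω| * (C * |V ω| ^ 3 * r ω) := by gcongr; exact hR ω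
      _ = C * (|V ω| ^ 4 * r ω) := by ring
      _ ≤ C * (|V ω| ^ 4 * r ω ^ 2) := by gcongr; exact hrr ω
      _ = _ := by rw [h3]
  have hVR2 : |∫ ω, V ω ∂P| * |∫ ω, R ω ∂P| ≤
      C * ((∫ ω, r ω ^ 2 ∂P + 3) / 4) * e := by
    have h1 : |∫ ω, V ω ∂P| ≤ l := abs_integral_le_integral_abs
    have h2 : |∫ ω, R ω ∂P| ≤ ∫ ω, |R ω| ∂P := abs_integral_le_integral_abs
    have h3 : l * ∫ ω, |R ω| ∂P ≤
        ∫ ω, (C / 4 * l ^ 4 * r ω ^ 2 + 3 * (C / 4) * (V ω ^ 4 * r ω ^ 2)) ∂P := by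
      rw [← integral_const_mul]
      refine integral_mono (hRi.abs.const_mul l)
        ((hir.const_mul _).add (hi.const_mul _)) fun ω => ?_
      have h4 := hamgm l |V ω| hl0 (abs_nonneg _)
      rw [Even.pow_abs (n := 4) (by decide) (V ω)] at h4
      calc l * |R ω| ≤ l * (C * |V ω| ^ 3 * r ω) := by gcongr; exact hR ω
        _ ≤ l * (C * |V ω| ^ 3 * r ω ^ 2) := by gcongr; exact hrr ω
        _ = C / 4 * r ω ^ 2 * (4 * (l * |V ω| ^ 3)) := by ring
        _ ≤ C / 4 * r ω ^ 2 * (l ^ 4 + 3 * V ω ^ 4) := by gcongr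
        _ = _ := by ring
    rw [integral_add (hir.const_mul _) (hi.const_mul _), integral_const_mul,
      integral_const_mul, ← he] at h3
    have hr2 : 0 ≤ ∫ ω, r ω ^ 2 ∂P := integral_nonneg fun ω => sq_nonneg _
    calc _ ≤ l * ∫ ω, |R ω| ∂P := by gcongr
      _ ≤ _ := h3
      _ ≤ C / 4 * e * ∫ ω, r ω ^ 2 ∂P + 3 * (C / 4) * e := by gcongr
      _ = _ := by ring
  have hcov : |cov[V, R; P]| ≤ C * (1 + (∫ ω, r ω ^ 2 ∂P + 3) / 4) * e := by
    rw [covariance_eq_sub hVL hRL]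
    refine (abs_sub _ _).trans ?_
    rw [abs_mul (∫ ω, V ω ∂P)]
    have : |∫ ω, (V * R) ω ∂P| ≤ C * e := hVR
    linarith
  have hvQ0 : 0 ≤ Var[fun ω => c₂ * V ω ^ 2 + R ω; P] := variance_nonneg _ _
  rw [hvar]
  set k₁ := cov[V, fun ω => V ω ^ 2; P]
  set k₂ := cov[V, R; P]
  set k₃ := Var[fun ω => c₂ * V ω ^ 2 + R ω; P]
  calc |c₁ ^ 2 * Var[V; P] + 2 * (c₁ * (c₂ * k₁ + k₂)) + k₃ - c₁ ^ 2 * Var[V; P]|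
      = |2 * c₁ * c₂ * k₁ + 2 * c₁ * k₂ + k₃| := by congr 1; ring
    _ ≤ |2 * c₁ * c₂ * k₁| + |2 * c₁ * k₂| + |k₃| := abs_add_three _ _ _
    _ = 2 * |c₁| * |c₂| * |k₁| + 2 * |c₁| * |k₂| + k₃ := by
        rw [abs_mul, abs_mul, abs_mul, abs_mul, abs_mul, abs_of_nonneg hvQ0, abs_two]
    _ ≤ _ := by
        have := mul_le_mul_of_nonneg_left hcov (by positivity : 0 ≤ 2 * |c₁|)
        linarith

end Variance

/-! ### Expansions at the order statistic of rank `⌈q k⌉` -/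

section RankAsymptotics

variable {q k : ℝ} {n ν : ℕ}

/-- For the rank `ν + 1 = ⌈q k⌉` in a sample of size `k = n + 3`, the variance `p (1 - p) / (k + 2)`
of the uniform order statistic with mean `p` is `q (1 - q) / k` up to `O(1 / k ^ 2)`. The second
quantity is the covariance of its deviation from `q` with the square of that deviation. -/
theorem abs_orderStatistic_variance_sub_le (hq0 : 0 < q) (hq1 : q < 1) (hk : k = n + 3) (hν : ν ≤ n)
    (h1 : q * k ≤ ν + 1) (h2 : (ν : ℝ) + 1 < q * k + 1) {p : ℝ} (hp : p = (ν + 1) / (k + 1)) :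
    |p * (1 - p) / (k + 2) - q * (1 - q) / k| ≤ 2 / k ^ 2 ∧
    |2 * p * (1 - p) * (1 - 2 * p) / ((k + 2) * (k + 3)) +
      2 * (p - q) * (p * (1 - p) / (k + 2))| ≤ 1 / k ^ 2 := by
  have hk0 : 3 ≤ k := by rw [hk]; linarith [Nat.cast_nonneg (α := ℝ) n]
  have hνn : (ν : ℝ) ≤ n := by exact_mod_cast hν
  have hpk : p * (k + 1) = ν + 1 := by rw [hp]; field_simp
  have hp0 : 0 ≤ p := by rw [hp]; positivity
  have hp1 : p ≤ 1 := by rw [hp, div_le_one (by linarith)]; linarith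
  have hs : |p - q| ≤ 1 / k := by
    have h3 : |p - q| * (k + 1) ≤ 1 := by
      rw [← abs_of_pos (by linarith : 0 < k + 1), ← abs_mul, abs_le]
      constructor <;> nlinarith
    rw [le_div_iff₀ (by linarith)]
    nlinarith [abs_nonneg (p - q)]
  have hpp0 : 0 ≤ p * (1 - p) := mul_nonneg hp0 (by linarith)
  have hpp : p * (1 - p) ≤ 1 / 4 := by nlinarith [sq_nonneg (p - 1 / 2)]
  have hqq0 : 0 ≤ q * (1 - q) := mul_nonneg hq0.le (by linarith)
  have hqq : q * (1 - q) ≤ 1 / 4 := by nlinarith [sq_nonneg (q - 1 / 2)]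
  constructor
  · have e : p * (1 - p) / (k + 2) - q * (1 - q) / k =
        (p - q) * (1 - p - q) / (k + 2) - q * (1 - q) * (2 / (k * (k + 2))) := by
      field_simp
      ring
    rw [e]
    have h3 : |(p - q) * (1 - p - q) / (k + 2)| ≤ 1 / k ^ 2 := by
      rw [abs_div, abs_mul, abs_of_pos (by linarith : 0 < k + 2)]
      have h4 : |1 - p - q| ≤ 1 := abs_le.2 ⟨by linarith, by linarith⟩
      calc |p - q| * |1 - p - q| / (k + 2) ≤ 1 / k * 1 / k := by gcongr; linarith
        _ = 1 / k ^ 2 := by field_simp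
    have h5 : |q * (1 - q) * (2 / (k * (k + 2)))| ≤ 1 / k ^ 2 := by
      rw [abs_of_nonneg (by positivity)]
      calc q * (1 - q) * (2 / (k * (k + 2))) ≤ 1 / 4 * (2 / (k * k)) := by gcongr; linarith
        _ ≤ 1 / k ^ 2 := by rw [← pow_two]; field_simp; norm_num
    calc _ ≤ _ := abs_sub _ _
      _ ≤ 1 / k ^ 2 + 1 / k ^ 2 := add_le_add h3 h5
      _ = 2 / k ^ 2 := by ring
  · have h3 : |2 * p * (1 - p) * (1 - 2 * p) / ((k + 2) * (k + 3))| ≤ 1 / 2 / k ^ 2 := by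
      rw [abs_div, abs_of_pos (by positivity : 0 < (k + 2) * (k + 3)), mul_assoc 2 p, abs_mul,
        abs_of_nonneg (by positivity : 0 ≤ 2 * (p * (1 - p)))]
      have h4 : |1 - 2 * p| ≤ 1 := abs_le.2 ⟨by linarith, by linarith⟩
      calc 2 * (p * (1 - p)) * |1 - 2 * p| / ((k + 2) * (k + 3))
          ≤ 2 * (1 / 4) * 1 / (k * k) := by gcongr <;> linarith
        _ = 1 / 2 / k ^ 2 := by field_simp; norm_num
    have h5 : |2 * (p - q) * (p * (1 - p) / (k + 2))| ≤ 1 / 2 / k ^ 2 := by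
      rw [abs_mul, abs_mul, abs_two, abs_of_nonneg (by positivity : 0 ≤ p * (1 - p) / (k + 2))]
      calc 2 * |p - q| * (p * (1 - p) / (k + 2)) ≤ 2 * (1 / k) * (1 / 4 / k) := by
            gcongr; linarith
        _ = 1 / 2 / k ^ 2 := by field_simp; norm_num
    calc _ ≤ _ := abs_add_le _ _
      _ ≤ 1 / 2 / k ^ 2 + 1 / 2 / k ^ 2 := add_le_add h3 h5
      _ = 1 / k ^ 2 := by ring

/-- For large `k` the weight `(1 - u) ^ (-2)` costs at most a constant factor: it lowers the sample
size by two, from `k = n + 3` to `k - 2`. -/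
theorem weighted_moments_le (hq0 : 0 < q) (hq1 : q < 1) (hk : k = n + 3) (hν : ν ≤ n)
    (hkq : 4 ≤ (1 - q) * k) (h1 : q * k ≤ ν + 1) (h2 : (ν : ℝ) + 1 < q * k + 1) :
    ∫ u, 1 / (1 - u) ^ 2 ∂(orderLaw (n + 2) ν) ≤ 4 / (1 - q) ^ 2 ∧
    ∫ u, (u - q) ^ 4 / (1 - u) ^ 2 ∂(orderLaw (n + 2) ν) ≤ 2304 / (1 - q) ^ 2 / k ^ 2 := by
  have := isProbabilityMeasure_orderLaw n ν hν
  have hk0 : 3 ≤ k := by rw [hk]; linarith [Nat.cast_nonneg (α := ℝ) n]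
  have hq1' : 0 < 1 - q := by linarith
  have hn2 : (n : ℝ) + 2 = k - 1 := by rw [hk]; ring
  have hc : ((n : ℝ) + 2) * (n + 3) / ((n + 1 - ν) * (n + 2 - ν)) ≤ 4 / (1 - q) ^ 2 := by
    have e1 : (1 - q) * k / 2 ≤ (n : ℝ) + 1 - ν := by linarith
    have e2 : (1 - q) * k / 2 ≤ (n : ℝ) + 2 - ν := by linarith
    have e0 : 0 < (1 - q) * k / 2 := by positivity
    calc ((n : ℝ) + 2) * (n + 3) / ((n + 1 - ν) * (n + 2 - ν))
        ≤ k * k / ((1 - q) * k / 2 * ((1 - q) * k / 2)) := by gcongr <;> linarith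
      _ = 4 / (1 - q) ^ 2 := by field_simp; norm_num
  have h0 := (integral_div_orderLaw n ν hν (f := fun _ => 1) continuous_const).2
  have h4 := (integral_div_orderLaw n ν hν (f := fun u => (u - q) ^ 4) (by fun_prop)).2
  simp only [integral_const, probReal_univ, one_smul, mul_one] at h0
  refine ⟨h0.trans_le hc, ?_⟩
  have h5 : ∫ u, (u - q) ^ 4 ∂(orderLaw n ν) ≤ 144 / (k - 1) ^ 2 := by
    refine integral_sub_pow_four_orderLaw_le n ν hν hn2.symm ?_
    have h6 : (0 : ℝ) < k - 1 := by linarith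
    have h7 : ((ν : ℝ) + 1) / (k - 1) - q = (ν + 1 - q * (k - 1)) / (k - 1) := by field_simp
    rw [h7, abs_div, abs_of_pos h6]
    gcongr
    exact abs_le.2 ⟨by nlinarith, by nlinarith⟩
  have h6 : 144 / (k - 1) ^ 2 ≤ 576 / k ^ 2 := by
    rw [div_le_div_iff₀ (by nlinarith) (by positivity)]
    nlinarith
  rw [h4]
  calc _ ≤ 4 / (1 - q) ^ 2 * (576 / k ^ 2) := by
        refine mul_le_mul hc (h5.trans h6) (integral_nonneg fun u => ?_) (by positivity)
        exact Even.pow_nonneg (by decide) _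
    _ = _ := by field_simp; norm_num

end RankAsymptotics

/-- The variance of a statistic `T` with a second-order expansion in the deviation from `q` of a
uniform order statistic of rank `⌈q k⌉`. -/
theorem exists_variance_orderLaw_bound {Ω : Type*} [MeasurableSpace Ω] (P : Measure Ω)
    [IsProbabilityMeasure P] {q : ℝ} (hq0 : 0 < q) (hq1 : q < 1) (c₀ c₁ c₂ : ℝ) {C : ℝ}
    (hC : 0 ≤ C) :
    ∃ K, ∀ (k : ℝ) (n ν : ℕ) (U T : Ω → ℝ), k = n + 3 → ν ≤ n → 4 ≤ (1 - q) * k →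
      q * k ≤ ν + 1 → (ν : ℝ) + 1 < q * k + 1 → AEMeasurable U P → AEMeasurable T P →
      (∀ ω, 0 ≤ U ω) → (∀ ω, U ω < 1) → P.map U = orderLaw (n + 2) ν →
      (∀ ω, |T ω - c₀ - c₁ * (U ω - q) - c₂ * (U ω - q) ^ 2| ≤
        C * |U ω - q| ^ 3 * (1 / (1 - U ω))) →
      MemLp T 2 P ∧ |Var[T; P] - c₁ ^ 2 * (q * (1 - q)) / k| ≤ K / k ^ 2 := by
  have hq1' : 0 < 1 - q := by linarith
  refine ⟨2 * |c₁| * |c₂| + 2 * |c₁| * C * (1 + (4 / (1 - q) ^ 2 + 3) / 4) *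
    (2304 / (1 - q) ^ 2) + 2 * (c₂ ^ 2 + C ^ 2) * (2304 / (1 - q) ^ 2) + 2 * c₁ ^ 2, ?_⟩
  intro k n ν U T hk hν hkq h1 h2 hU hT hU0 hU1 hlaw hR
  have hk0 : 3 ≤ k := by rw [hk]; linarith [Nat.cast_nonneg (α := ℝ) n]
  have hν2 : ν ≤ n + 2 := by omega
  have := isProbabilityMeasure_orderLaw (n + 2) ν hν2
  have hexp : ∀ {f : ℝ → ℝ}, Measurable f →
      ∫ ω, f (U ω) ∂P = ∫ u, f u ∂(orderLaw (n + 2) ν) := fun hf => by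
    rw [← hlaw, integral_map hU hf.aestronglyMeasurable]
  have hint : ∀ {f : ℝ → ℝ}, Measurable f → Integrable f (orderLaw (n + 2) ν) →
      Integrable (fun ω => f (U ω)) P := fun hf hi => by
    rw [← hlaw] at hi
    exact (integrable_map_measure hf.aestronglyMeasurable hU).1 hi
  have hw4 : ∀ ω, (U ω - q) ^ 4 * (1 / (1 - U ω)) ^ 2 = (U ω - q) ^ 4 / (1 - U ω) ^ 2 := fun ω => by
    rw [div_pow, one_pow, mul_one_div]
  have hw0 : ∀ ω, (1 / (1 - U ω)) ^ 2 = 1 / (1 - U ω) ^ 2 := fun ω => by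
    rw [div_pow, one_pow]
  have hV1 : ∀ ω, |U ω - q| ≤ 1 := fun ω =>
    abs_le.2 ⟨by linarith [hU0 ω], by linarith [hU1 ω]⟩
  have hVm : AEMeasurable (fun ω => U ω - q) P := hU.sub_const q
  have main := variance_expansion (V := fun ω => U ω - q) (r := fun ω => 1 / (1 - U ω)) hVm hT hV1
    (fun ω => by rw [le_div_iff₀ (by linarith [hU1 ω])]; linarith [hU0 ω]) hC hR
    (by
      simp only [hw4]
      exact hint (f := fun u => (u - q) ^ 4 / (1 - u) ^ 2) (by fun_prop)
        (integral_div_orderLaw n ν hν (f := fun u => (u - q) ^ 4) (by fun_prop)).1)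
    (by
      simp only [hw0]
      exact hint (f := fun u => 1 / (1 - u) ^ 2) (by fun_prop)
        (integral_div_orderLaw n ν hν (f := fun _ => 1) (by fun_prop)).1)
  refine ⟨main.1, ?_⟩
  have hbd := main.2
  simp only [hw4] at hbd
  simp only [hw0] at hbd
  rw [hexp (f := fun u => (u - q) ^ 4 / (1 - u) ^ 2) (by fun_prop),
    hexp (f := fun u => 1 / (1 - u) ^ 2) (by fun_prop)] at hbd
  obtain ⟨hE0, hE4⟩ := weighted_moments_le hq0 hq1 hk hν hkq h1 h2
  set p : ℝ := (ν + 1) / (k + 1) with hp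
  have hN : k + 1 = ((n + 2 : ℕ) : ℝ) + 2 := by rw [hk]; push_cast; ring
  obtain ⟨hv, hc⟩ := abs_orderStatistic_variance_sub_le hq0 hq1 hk hν h1 h2 hp
  have m1 := integral_sub_orderLaw (n + 2) ν hν2 hN hp q
  have m2 := integral_sub_sq_orderLaw (n + 2) ν hν2 hN hp q
  have m3 := integral_sub_cube_orderLaw (n + 2) ν hν2 hN hp q
  have hVL : MemLp (fun ω => U ω - q) 2 P :=
    MemLp.of_bound hVm.aestronglyMeasurable 1 (ae_of_all _ hV1)
  have hV2L : MemLp (fun ω => (U ω - q) ^ 2) 2 P :=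
    MemLp.of_bound (hVm.pow_const 2).aestronglyMeasurable 1 (ae_of_all _ fun ω => by
      rw [norm_pow]; exact pow_le_one₀ (norm_nonneg _) (hV1 ω))
  have hvar : Var[fun ω => U ω - q; P] = p * (1 - p) / (k + 2) := by
    rw [variance_eq_sub hVL]
    simp only [Pi.pow_apply]
    rw [hexp (f := fun u => (u - q) ^ 2) (by fun_prop), hexp (f := fun u => u - q) (by fun_prop),
      m1, m2]
    ring
  have hcov : cov[fun ω => U ω - q, fun ω => (U ω - q) ^ 2; P] =
      2 * p * (1 - p) * (1 - 2 * p) / ((k + 2) * (k + 3)) +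
        2 * (p - q) * (p * (1 - p) / (k + 2)) := by
    have e3 : (fun ω => U ω - q) * (fun ω => (U ω - q) ^ 2) = fun ω => (U ω - q) ^ 3 := by
      funext ω
      simp only [Pi.mul_apply]
      ring
    rw [covariance_eq_sub hVL hV2L, e3, hexp (f := fun u => (u - q) ^ 3) (by fun_prop),
      hexp (f := fun u => (u - q) ^ 2) (by fun_prop), hexp (f := fun u => u - q) (by fun_prop),
      m1, m2, m3]
    ring
  rw [hvar, hcov] at hbd
  have hE4' : 0 ≤ ∫ u, (u - q) ^ 4 / (1 - u) ^ 2 ∂(orderLaw (n + 2) ν) :=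
    integral_nonneg fun u => by
      have : 0 ≤ (u - q) ^ 4 := Even.pow_nonneg (by decide) _
      positivity
  calc |Var[T; P] - c₁ ^ 2 * (q * (1 - q)) / k|
      = |(Var[T; P] - c₁ ^ 2 * (p * (1 - p) / (k + 2))) +
          c₁ ^ 2 * (p * (1 - p) / (k + 2) - q * (1 - q) / k)| := by congr 1; ring
    _ ≤ |Var[T; P] - c₁ ^ 2 * (p * (1 - p) / (k + 2))| +
          c₁ ^ 2 * |p * (1 - p) / (k + 2) - q * (1 - q) / k| := by
        refine (abs_add_le _ _).trans_eq ?_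
        rw [abs_mul (c₁ ^ 2), abs_of_nonneg (sq_nonneg c₁)]
    _ ≤ (2 * |c₁| * |c₂| * (1 / k ^ 2) +
        2 * |c₁| * C * (1 + (4 / (1 - q) ^ 2 + 3) / 4) * (2304 / (1 - q) ^ 2 / k ^ 2) +
        2 * (c₂ ^ 2 + C ^ 2) * (2304 / (1 - q) ^ 2 / k ^ 2)) + c₁ ^ 2 * (2 / k ^ 2) := by
        refine add_le_add (hbd.trans ?_) (by gcongr)
        gcongr
    _ = _ := by ring

/-! ### The quantile estimator -/

theorem quantile_eq_of_strictMono {F : ℝ → ℝ} (hF : StrictMono F) {p y : ℝ} (hy : F y = p) :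
    quantile F p = y := by
  have : {t : ℝ | p ≤ F t} = Set.Ici y := by
    ext t
    rw [Set.mem_ofPred_eq, ← hy, hF.le_iff_le, Set.mem_Ici]
  rw [quantile, this, csInf_Ici]

namespace IsStableLaw

variable {α : ℝ} {μ : Measure ℝ}

theorem exists_cdf_eq (hμ : IsStableLaw α 1 μ) (hα : 0 < α) {p : ℝ} (hp0 : 0 < p) (hp1 : p < 1) :
    ∃ y, cdf μ y = p := by
  have := hμ.1
  obtain ⟨a, ha⟩ := ((tendsto_cdf_atBot μ).eventually_lt_const hp0).exists
  obtain ⟨b, hb⟩ := ((tendsto_cdf_atTop μ).eventually_const_lt hp1).exists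
  exact mem_range_of_exists_le_of_exists_ge (hμ.continuous_cdf hα one_pos) ⟨a, ha.le⟩ ⟨b, hb.le⟩

theorem strictMonoOn_cdf_abs (hμ : IsStableLaw α 1 μ) (hα : 0 < α) (hα2 : α ≤ 2) :
    StrictMonoOn (cdf (μ.map fun x => |x|)) (Set.Ici 0) := by
  intro a ha b hb hab
  rw [hμ.cdf_abs hα one_pos ha, hμ.cdf_abs hα one_pos hb]
  linarith [hμ.strictMono_cdf hα hα2 hab]

theorem cdf_abs_lt_one (hμ : IsStableLaw α 1 μ) (hα : 0 < α) (hα2 : α ≤ 2) {y : ℝ} (hy : 0 ≤ y) :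
    cdf (μ.map fun x => |x|) y < 1 := by
  have h := hμ.strictMonoOn_cdf_abs hα hα2 hy (show y + 1 ∈ Set.Ici (0 : ℝ) by simp; linarith)
    (by linarith)
  exact h.trans_le (cdf_le_one _ _)

/-- The estimator, as a function of the `q`-quantile of the normalized sample, has a second-order
expansion in powers of `G - q`, where `G` is the distribution function of `|X|`. -/
theorem exists_estimator_expansion (hμ : IsStableLaw α 1 μ) (hα : 0 < α) (hα2 : α ≤ 2) {d W : ℝ}
    (hd : 0 < d) (hW : 0 < W) :
    ∃ c C, 0 ≤ C ∧ ∀ y, 0 ≤ y →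
      |d * (y / W) ^ α - d - d * α / (2 * W * invDensity μ W) *
        (cdf (μ.map fun x => |x|) y - cdf (μ.map fun x => |x|) W) -
        c * (cdf (μ.map fun x => |x|) y - cdf (μ.map fun x => |x|) W) ^ 2| ≤
        C * |cdf (μ.map fun x => |x|) y - cdf (μ.map fun x => |x|) W| ^ 3 *
          (1 / (1 - cdf (μ.map fun x => |x|) y)) := by
  have := hμ.1
  set G : ℝ → ℝ := fun y => cdf (μ.map fun x => |x|) y with hG
  set h : ℝ → ℝ := fun y => d * (y / W) ^ α with hh
  have hGeq : ∀ y ∈ Set.Ioi (0 : ℝ), G y = 2 * cdf μ y - 1 := fun y hy =>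
    hμ.cdf_abs hα one_pos (le_of_lt hy)
  have hGc : ContDiffOn ℝ 3 G (Set.Ioi 0) := by
    have h1 : ContDiff ℝ 3 (cdf μ) := by
      have := hμ.contDiff_cdf hα one_pos 2
      norm_num at this
      exact this
    exact ((contDiff_const.mul h1).sub contDiff_const).contDiffOn.congr hGeq
  have hGd : deriv G W = 2 * invDensity μ W := by
    have h1 : G =ᶠ[𝓝 W] fun y => 2 * cdf μ y - 1 := by
      filter_upwards [Ioi_mem_nhds hW] with y hy using hGeq y hy
    rw [h1.deriv_eq]
    exact (((hμ.hasDerivAt_cdf hα one_pos W).const_mul 2).sub_const 1).deriv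
  have hhc : ContDiffOn ℝ 3 h (Set.Ioi 0) := by
    refine contDiffOn_const.mul (ContDiffOn.rpow_const_of_ne (contDiffOn_id.div_const W) ?_)
    intro y hy
    exact (div_pos hy hW).ne'
  have hWW : W / W = 1 := div_self hW.ne'
  have hhd : deriv h W = d * α / W := by
    have h1 : HasDerivAt (fun y : ℝ => y / W) (1 / W) W := (hasDerivAt_id W).div_const W
    have h2 := (h1.rpow_const (p := α) (Or.inl (by rw [hWW]; exact one_ne_zero))).const_mul d
    rw [h2.deriv, hWW, Real.one_rpow]
    ring
  have hhW : h W = d := by simp only [hh, hWW, Real.one_rpow, mul_one]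
  have hf := hμ.invDensity_pos hα hα2 W
  have hmono : StrictMonoOn G (Set.Ici 0) := hμ.strictMonoOn_cdf_abs hα hα2
  have hbound : ∀ y, 0 ≤ y → |h y| ≤ 2 * d * (2 / W) ^ α / (1 - G y) := by
    intro y hy
    have hy1 : 0 < 1 - G y := sub_pos.2 (hμ.cdf_abs_lt_one hα hα2 hy)
    have hnn : 0 ≤ h y := by positivity
    rw [abs_of_nonneg hnn, le_div_iff₀ hy1]
    rcases hy.eq_or_lt with rfl | hy0
    · simp only [hh, zero_div, Real.zero_rpow hα.ne', mul_zero, zero_mul]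
      positivity
    · calc h y * (1 - G y) ≤ h y * (2 * (2 / y) ^ α) :=
            mul_le_mul_of_nonneg_left (hμ.one_sub_cdf_abs_le hα hy0) hnn
        _ = 2 * d * ((y / W) ^ α * (2 / y) ^ α) := by simp only [hh]; ring
        _ = 2 * d * (2 / W) ^ α := by
            rw [← Real.mul_rpow (by positivity) (by positivity)]
            congr 2
            field_simp
  obtain ⟨c, C, hC, hcC⟩ := exists_global_expansion hW hhc hGc (by rw [hGd]; positivity) hmono
    (fun y _ => cdf_nonneg _ _) (fun y hy => hμ.cdf_abs_lt_one hα hα2 hy) hbound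
  refine ⟨c, C, hC, fun y hy => ?_⟩
  have h1 := hcC y hy
  rw [hhW, hGd, hhd] at h1
  have e : d * α / W / (2 * invDensity μ W) = d * α / (2 * W * invDensity μ W) := by
    field_simp
  rwa [e] at h1

end IsStableLaw

theorem lemma1 {Ω : Type*} [MeasurableSpace Ω] (P : Measure Ω) [IsProbabilityMeasure P]
    (α d q W : ℝ) (hα0 : 0 < α) (hα2 : α ≤ 2) (hd : 0 < d) (hq0 : 0 < q) (hq1 : q < 1)
    (hW : W = quantile (stableCDF α 1) ((q + 1) / 2))
    (x : ℕ → Ω → ℝ) (hx : ∀ j, HasLaw (x j) (stableLaw α d) P) (hind : iIndepFun x P) :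
    -- `stablePDF α 1` is the continuous probability density of `S(α, 1)`
    (Continuous (stablePDF α 1) ∧
      stableLaw α 1 = volume.withDensity fun y => ENNReal.ofReal (stablePDF α 1 y)) ∧
    -- `W` is the inverse of the cumulative distribution function at `(q + 1) / 2`, and it is the
    -- `q`-quantile of `|S(α, 1)|`; the quantities in the denominators are positive
    (∀ y : ℝ, stableCDF α 1 y = (q + 1) / 2 ↔ y = W) ∧
    W = absStableQuantile α q ∧
    0 < W ∧ 0 < stablePDF α 1 W ∧
    -- the estimator has a finite second moment for all large sample sizes
    (∀ᶠ k : ℕ in atTop, MemLp (fun ω => quantileEstimator α q k fun j => x j ω) 2 P) ∧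
    -- the expansion of its variance
    (fun k : ℕ =>
        variance (fun ω => quantileEstimator α q k fun j => x j ω) P -
          1 / (k : ℝ) * (((q - q ^ 2) * α ^ 2 / 4) / (stablePDF α 1 W ^ 2 * W ^ 2)) * d ^ 2)
      =O[atTop] fun k : ℕ => 1 / (k : ℝ) ^ 2 := by
  -- `S(α, d)` is the law of `s X` with `s = d ^ (1 / α)` and `X ∼ S(α, 1)`
  set s : ℝ := d ^ α⁻¹ with hs
  have hs0 : 0 < s := Real.rpow_pos_of_pos hd _
  have hsα : s ^ α = d := Real.rpow_inv_rpow hd.le hα0.ne'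
  have hstd : IsStableLaw α d (stableLaw α d) := by
    have h := (hasLaw_stableLaw_iff.1 (hx 0)).2
    rwa [(hx 0).map_eq] at h
  set μ : Measure ℝ := (stableLaw α d).map fun y => s⁻¹ * y with hμdef
  have hμ : IsStableLaw α 1 μ := by
    have h := hstd.map_mul (inv_pos.2 hs0).le
    rwa [Real.inv_rpow hs0.le, hsα, mul_inv_cancel₀ hd.ne'] at h
  have hprob := hμ.1
  have hμ1 : stableLaw α 1 = μ := hμ.stableLaw_eq
  have hμd : stableLaw α d = μ.map fun y => s * y := by
    have h := hμ.map_mul hs0.le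
    rw [hsα, one_mul] at h
    exact h.stableLaw_eq
  have hcdf : stableCDF α 1 = cdf μ := by
    funext y
    rw [stableCDF, hμ1]
  have hpdf : stablePDF α 1 = invDensity μ := by
    funext y
    rw [stablePDF, hcdf]
    exact (hμ.hasDerivAt_cdf hα0 one_pos y).deriv
  have hint := hμ.integrable_charFun hα0 one_pos
  have hmono := hμ.strictMono_cdf hα0 hα2
  rw [hcdf] at hW
  have hFW : cdf μ W = (q + 1) / 2 := by
    obtain ⟨y, hy⟩ := hμ.exists_cdf_eq hα0 (p := (q + 1) / 2) (by linarith) (by linarith)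
    rw [hW, quantile_eq_of_strictMono hmono hy, hy]
  have hW0 : 0 < W := by
    rw [← hmono.lt_iff_lt, hFW, hμ.cdf_zero hα0 one_pos]
    linarith
  set G : ℝ → ℝ := fun y => cdf (μ.map fun x => |x|) y with hG
  have hGW : G W = q := by
    rw [hG]
    simp only
    rw [hμ.cdf_abs hα0 one_pos hW0.le, hFW]
    ring
  have hGmono : StrictMonoOn G (Set.Ici 0) := hμ.strictMonoOn_cdf_abs hα0 hα2
  have hWq : W = absStableQuantile α q := by
    have h : {t : ℝ | q ≤ cdf (μ.map fun x => |x|) t} = Set.Ici W := by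
      ext t
      rw [Set.mem_ofPred_eq, Set.mem_Ici]
      rcases lt_or_ge t 0 with ht | ht
      · rw [cdf_map_abs_of_neg μ ht]
        constructor <;> intro h <;> linarith
      · rw [← hGW]
        exact hGmono.le_iff_le hW0.le ht
    rw [absStableQuantile, hμ1, quantile, h, csInf_Ici]
  have hfW := hμ.invDensity_pos hα0 hα2 W
  obtain ⟨c, C, hC, hexp⟩ := hμ.exists_estimator_expansion hα0 hα2 hd hW0
  obtain ⟨K, hK⟩ := exists_variance_orderLaw_bound P hq0 hq1 d
    (d * α / (2 * W * invDensity μ W)) c hC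
  have key : ∀ᶠ k : ℕ in atTop,
      MemLp (fun ω => quantileEstimator α q k fun j => x j ω) 2 P ∧
      |Var[fun ω => quantileEstimator α q k fun j => x j ω; P] -
        (d * α / (2 * W * invDensity μ W)) ^ 2 * (q * (1 - q)) / k| ≤ K / (k : ℝ) ^ 2 := by
    have hlarge : ∀ᶠ k : ℕ in atTop, 4 ≤ (1 - q) * (k : ℝ) :=
      (tendsto_natCast_atTop_atTop.const_mul_atTop (by linarith)).eventually_ge_atTop 4
    filter_upwards [hlarge, eventually_ge_atTop 3] with k hk4 hk3
    have hk : 0 < k := by omega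
    have hkR : (0 : ℝ) < k := by exact_mod_cast hk
    have hceil0 : 0 < ⌈q * k⌉₊ := Nat.ceil_pos.2 (by positivity)
    obtain ⟨n, hn⟩ : ∃ n, k = n + 3 := ⟨k - 3, by omega⟩
    obtain ⟨ν, hν⟩ : ∃ ν, ⌈q * k⌉₊ = ν + 1 := ⟨⌈q * k⌉₊ - 1, by omega⟩
    have hνR : ((⌈q * k⌉₊ : ℕ) : ℝ) = ν + 1 := by rw [hν]; push_cast; rfl
    have h1 : q * k ≤ ν + 1 := hνR ▸ Nat.le_ceil (q * k)
    have h2 : (ν : ℝ) + 1 < q * k + 1 := hνR ▸ Nat.ceil_lt_add_one (by positivity)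
    have hνn : ν ≤ n := by
      have h3 : (k : ℝ) = n + 3 := by rw [hn]; push_cast; rfl
      have : (ν : ℝ) ≤ n := by linarith
      exact_mod_cast this
    -- the `q`-quantile of the normalized sample
    set Q₀ : Ω → ℝ := fun ω => quantile (empiricalCDF k fun j => |x j ω|) q with hQ₀
    set Q : Ω → ℝ := fun ω => Q₀ ω / s with hQ
    have hxm : ∀ j, AEMeasurable (x j) P := fun j => (hx j).aemeasurable
    have habs : ∀ j, AEMeasurable (fun ω => |x j ω|) P := fun j =>
      continuous_abs.measurable.comp_aemeasurable (hxm j)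
    have hQ₀m : AEMeasurable Q₀ P :=
      (measurable_quantile_empiricalCDF hq0 hq1 hk).comp_aemeasurable
        (aemeasurable_pi_lambda _ habs)
    have hQm : AEMeasurable Q P := hQ₀m.div_const s
    have hQ₀0 : ∀ ω, 0 ≤ Q₀ ω := fun ω =>
      quantile_empiricalCDF_nonneg hq0 hk fun j => abs_nonneg _
    have hQ0 : ∀ ω, 0 ≤ Q ω := fun ω => div_nonneg (hQ₀0 ω) hs0.le
    have hindabs : iIndepFun (fun j ω => |x j ω|) P :=
      hind.comp (fun _ y => |y|) fun _ => continuous_abs.measurable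
    have hmarg : ∀ t j, P.real {ω | |x j ω| ≤ s * t} = G t := by
      intro t j
      have hm : MeasurableSet {y : ℝ | |y| ≤ s * t} :=
        measurableSet_le continuous_abs.measurable measurable_const
      have h3 : (P.map (x j)).real {y : ℝ | |y| ≤ s * t} = P.real {ω | |x j ω| ≤ s * t} :=
        map_measureReal_apply_of_aemeasurable (hxm j) hm
      rw [← h3, (hx j).map_eq, hμd, hμ.cdf_abs_scale hs0, mul_div_cancel_left₀ _ hs0.ne']
    have hQcdf : ∀ t, 0 ≤ t →
        P.real {ω | Q ω ≤ t} = binomialTail (n + 2 + 1) (ν + 1) (G t) := by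
      intro t _
      have h3 : {ω | Q ω ≤ t} =
          {ω | ν + 1 ≤ ((Finset.range k).filter fun j => |x j ω| ≤ s * t).card} := by
        ext ω
        rw [Set.mem_ofPred_eq, Set.mem_ofPred_eq, hQ]
        simp only
        rw [div_le_iff₀ hs0, mul_comm t s, hQ₀, ← hν]
        exact quantile_empiricalCDF_le_iff hq0 hq1 hk _ _
      rw [h3, measureReal_le_card_filter_eq_binomialTail habs hindabs (hmarg t), hn]
    have hlaw : P.map (fun ω => G (Q ω)) = orderLaw (n + 2) ν := by
      refine map_eq_orderLaw hQm hQ0 (monotone_cdf _).measurable hGmono ?_ ?_ ?_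
        (by omega) hQcdf
      · refine (((hμ.continuous_cdf hα0 one_pos).const_mul 2).sub
          continuous_const).continuousOn.congr fun y hy => hμ.cdf_abs hα0 one_pos hy
      · show cdf (μ.map fun x => |x|) 0 = 0
        rw [hμ.cdf_abs hα0 one_pos le_rfl, hμ.cdf_zero hα0 one_pos]
        norm_num
      · exact tendsto_cdf_atTop _
    have hest : (fun ω => quantileEstimator α q k fun j => x j ω) =
        fun ω => d * (Q ω / W) ^ α := by
      funext ω
      rw [quantileEstimator, ← hWq, ← hsα, ← Real.mul_rpow hs0.le (div_nonneg (hQ0 ω) hW0.le)]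
      congr 1
      simp only [hQ, hQ₀]
      field_simp
    rw [hest]
    refine hK k n ν (fun ω => G (Q ω)) _ (by rw [hn]; push_cast; rfl) hνn hk4 h1 h2
      ((monotone_cdf _).measurable.comp_aemeasurable hQm) ?_ (fun ω => cdf_nonneg _ _)
      (fun ω => hμ.cdf_abs_lt_one hα0 hα2 (hQ0 ω)) hlaw fun ω => ?_
    · exact ((hQm.div_const W).pow_const α).const_mul d
    · have h3 := hexp (Q ω) (hQ0 ω)
      rw [show cdf (μ.map fun x => |x|) W = q from hGW] at h3
      exact h3
  refine ⟨⟨?_, ?_⟩, ?_, hWq, hW0, ?_, key.mono fun k hk => hk.1, ?_⟩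
  · rw [hpdf]
    exact continuous_invDensity μ hint
  · rw [hpdf, hμ1]
    exact eq_withDensity_invDensity μ hint
  · intro y
    rw [hcdf, ← hFW]
    exact hmono.injective.eq_iff
  · rw [hpdf]
    exact hfW
  · refine IsBigO.of_bound K (key.mono fun k hk => ?_)
    rw [hpdf, Real.norm_eq_abs, Real.norm_of_nonneg (by positivity), mul_one_div]
    convert hk.2 using 3
    field_simp
    ring
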